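/- Let $N\ge 1$ be an integer, $k\in\{0,\dots,\lfloor (N-1)/2\rfloor\}$, $\alpha\in\mathbb R\setminus\{0\}$, $p>1$ and $\omega>\frac{\alpha^2}{(N-2k)^2}$. Let $\mathbb K$ be $\mathbb R$ or $\mathbb C$, let $L^2(\mathcal G)=\bigoplus_{j=1}^N L^2(\mathbb R_+;\mathbb K)$ with scalar product $(\cdot,\cdot)_2$ (linear in the first argument), and let $H^m(\mathcal G)=\bigoplus_{j=1}^N H^m(\mathbb R_+;\mathbb K)$ for $m=1,2$. For $a_k=\tanh^{-1}\!\big(\frac{\alpha}{(2k-N)\sqrt\omega}\big)$ define, for $x>0$, $$\varphi_{k,j}(x)=\Big[\tfrac{(p+1)\omega}{2}\,\mathrm{sech}^2\!\big(\tfrac{(p-1)\sqrt\omega}{2}x-a_k\big)\Big]^{\frac1{p-1}}\ (1\le j\le k),\qquad \varphi_{k,j}(x)=\Big[\tfrac{(p+1)\omega}{2}\,\mathrm{sech}^2\!\big(\tfrac{(p-1)\sqrt\omega}{2}x+a_k\big)\Big]^{\frac1{p-1}}\ (k<j\le N).$$ Let $\mathcal E=\{V\in H^1(\mathcal G): v_1(0)=\dots=v_N(0)\}$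 and $$D_\alpha=\Big\{V\in H^2(\mathcal G): v_1(0)=\dots=v_N(0),\ \sum_{j=1}^N v_j'(0)=\alpha v_1(0)\Big\}.$$ For $F,G\in\mathcal E$ put $$B^\alpha_{1,k}(F,G)=\sum_{j=1}^N\int_0^\infty\big(f_j'\overline{g_j'}+\omega f_j\overline{g_j}-p\,\varphi_{k,j}^{p-1}f_j\overline{g_j}\big)dx+\alpha f_1(0)\overline{g_1(0)},$$ $$B^\alpha_{2,k}(F,G)=\sum_{j=1}^N\int_0^\infty\big(f_j'\overline{g_j'}+\omega f_j\overline{g_j}-\varphi_{k,j}^{p-1}f_j\overline{g_j}\big)dx+\alpha f_1(0)\overline{g_1(0)}$$ (the conjugations are void if $\mathbb K=\mathbb R$). Then $B^\alpha_{1,k}$ and $B^\alpha_{2,k}$, with domain $\mathcal E$, are densely defined symmetric forms in $L^2(\mathcal G)$, bounded from below and closed. For $i\in\{1,2\}$ the operator $\mathbf L^\alpha_{i,k}$ associated with $B^\alpha_{i,k}$, that is, the operator given by $\mathbf L^\alpha_{i,k}V=W$ on $$\mathrm{dom}(\mathbf L^\alpha_{i,k})=\{V\in\mathcal E:\ \exists\,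 W\in L^2(\mathcal G)\ \ \forall Z\in\mathcal E,\ B^\alpha_{i,k}(V,Z)=(W,Z)_2\},$$ is well defined and self-adjoint, its domain is exactly $D_\alpha$, and for $V=(v_j)_{j=1}^N\in D_\alpha$ $$\mathbf L^\alpha_{1,k}V=\big(-v_j''+\omega v_j-p\,\varphi_{k,j}^{p-1}v_j\big)_{j=1}^N,\qquad \mathbf L^\alpha_{2,k}V=\big(-v_j''+\omega v_j-\varphi_{k,j}^{p-1}v_j\big)_{j=1}^N.$$ -/

import Mathlib

open scoped ENNReal Topology ComplexConjugate
open MeasureTheory Set Filter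

noncomputable section

namespace StarGraph

/-! ## Sobolev spaces on the half-line

The scalar field `𝕜` is `ℝ` or `ℂ`. -/

/-- Lebesgue measure on the half-line `(0, ∞)`. -/
abbrev halfLine : Measure ℝ := volume.restrict (Ioi (0 : ℝ))

/-- The space `L²(ℝ₊)`. -/
abbrev L2Half (𝕜 : Type*) [RCLike 𝕜] : Type _ := Lp 𝕜 2 halfLine

/-- `w ∈ L²(ℝ₊)` is the weak derivative of `u ∈ L²(ℝ₊)` on `(0, ∞)`:
`∫ φ' u = - ∫ φ w` for all test functions `φ ∈ C_c^∞((0, ∞))`. -/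
def HasWeakDeriv {𝕜 : Type*} [RCLike 𝕜] (u w : L2Half 𝕜) : Prop :=
  ∀ φ : ℝ → ℝ, ContDiff ℝ (⊤ : ℕ∞) φ → HasCompactSupport φ → tsupport φ ⊆ Ioi (0 : ℝ) →
    ∫ x in Ioi (0 : ℝ), deriv φ x • u x = - ∫ x in Ioi (0 : ℝ), φ x • w x

/-- `u ∈ H¹(ℝ₊)`. -/
def MemH1 {𝕜 : Type*} [RCLike 𝕜] (u : L2Half 𝕜) : Prop := ∃ w : L2Half 𝕜, HasWeakDeriv u w

open scoped Classical in
/-- The weak derivative `u'` of `u ∈ H¹(ℝ₊)` (and `0` if `u ∉ H¹(ℝ₊)`). -/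
def weakDeriv {𝕜 : Type*} [RCLike 𝕜] (u : L2Half 𝕜) : L2Half 𝕜 :=
  if h : MemH1 u then h.choose else 0

/-- `u ∈ H²(ℝ₊)`. -/
def MemH2 {𝕜 : Type*} [RCLike 𝕜] (u : L2Half 𝕜) : Prop := MemH1 u ∧ MemH1 (weakDeriv u)

/-- The function `u` has a representative which is continuous on `[0, ∞)`, and the value of this
representative at the end point `0` is `a`. -/
def HasValueAtZero {𝕜 : Type*} [RCLike 𝕜] (u : L2Half 𝕜) (a : 𝕜) : Prop :=
  ∃ f : ℝ → 𝕜, ContinuousOn f (Ici (0 : ℝ)) ∧ u =ᵐ[halfLine] f ∧ f 0 = a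

open scoped Classical in
/-- The boundary value `u(0)` (and `0` if `u` has no continuous representative). -/
def valueAtZero {𝕜 : Type*} [RCLike 𝕜] (u : L2Half 𝕜) : 𝕜 :=
  if h : ∃ a : 𝕜, HasValueAtZero u a then h.choose else 0

section Facts

variable {𝕜 : Type*} [RCLike 𝕜]

theorem integrable_test_smul {φ : ℝ → ℝ} (hφ : Continuous φ) (hc : HasCompactSupport φ)
    (u : L2Half 𝕜) : Integrable (fun x => φ x • u x) halfLine := by
  have h1 : MemLp φ 2 halfLine := (hφ.memLp_of_hasCompactSupport (μ := volume) hc).restrict _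
  exact memLp_one_iff_integrable.1 (MemLp.smul (r := 1) (Lp.memLp u) h1)

theorem HasWeakDeriv.add {u v w z : L2Half 𝕜} (hu : HasWeakDeriv u w) (hv : HasWeakDeriv v z) :
    HasWeakDeriv (u + v) (w + z) := by
  intro φ hφ hc hs
  have hd : Continuous (deriv φ) := hφ.continuous_deriv (by simp)
  have e1 : ∫ x in Ioi (0 : ℝ), deriv φ x • (u + v : L2Half 𝕜) x
      = ∫ x in Ioi (0 : ℝ), (deriv φ x • u x + deriv φ x • v x) := by
    refine integral_congr_ae ?_
    filter_upwards [Lp.coeFn_add u v] with x hx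
    rw [hx, Pi.add_apply, smul_add]
  have e2 : ∫ x in Ioi (0 : ℝ), φ x • (w + z : L2Half 𝕜) x
      = ∫ x in Ioi (0 : ℝ), (φ x • w x + φ x • z x) := by
    refine integral_congr_ae ?_
    filter_upwards [Lp.coeFn_add w z] with x hx
    rw [hx, Pi.add_apply, smul_add]
  rw [e1, e2, integral_add (integrable_test_smul hd hc.deriv u) (integrable_test_smul hd hc.deriv v),
    integral_add (integrable_test_smul hφ.continuous hc w)
      (integrable_test_smul hφ.continuous hc z), hu φ hφ hc hs, hv φ hφ hc hs, neg_add]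

theorem HasWeakDeriv.smul {u w : L2Half 𝕜} (c : 𝕜) (hu : HasWeakDeriv u w) :
    HasWeakDeriv (c • u) (c • w) := by
  intro φ hφ hc hs
  have e1 : ∫ x in Ioi (0 : ℝ), deriv φ x • (c • u : L2Half 𝕜) x
      = ∫ x in Ioi (0 : ℝ), c • (deriv φ x • u x) := by
    refine integral_congr_ae ?_
    filter_upwards [Lp.coeFn_smul c u] with x hx
    rw [hx, Pi.smul_apply, smul_comm]
  have e2 : ∫ x in Ioi (0 : ℝ), φ x • (c • w : L2Half 𝕜) x
      = ∫ x in Ioi (0 : ℝ), c • (φ x • w x) := by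
    refine integral_congr_ae ?_
    filter_upwards [Lp.coeFn_smul c w] with x hx
    rw [hx, Pi.smul_apply, smul_comm]
  rw [e1, e2, integral_smul, integral_smul, hu φ hφ hc hs, smul_neg]

theorem HasWeakDeriv.zero : HasWeakDeriv (0 : L2Half 𝕜) 0 := by
  intro φ _ _ _
  have e (ψ : ℝ → ℝ) : ∫ x in Ioi (0 : ℝ), ψ x • (0 : L2Half 𝕜) x = 0 := by
    rw [← integral_zero ℝ 𝕜 (μ := halfLine)]
    refine integral_congr_ae ?_
    filter_upwards [Lp.coeFn_zero 𝕜 2 halfLine] with x hx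
    simp only [hx, Pi.zero_apply, smul_zero]
  rw [e, e, neg_zero]

/-- Weak derivatives are unique. -/
theorem HasWeakDeriv.unique {u w z : L2Half 𝕜} (hw : HasWeakDeriv u w) (hz : HasWeakDeriv u z) :
    w = z := by
  have key : ∀ᵐ x ∂(volume : Measure ℝ), x ∈ Ioi (0 : ℝ) → w x - z x = 0 := by
    refine isOpen_Ioi.ae_eq_zero_of_integral_contDiff_smul_eq_zero ?_ ?_
    · have hwz : MemLp (fun x => w x - z x) 2 halfLine := (Lp.memLp w).sub (Lp.memLp z)
      exact (hwz.locallyIntegrable (by norm_num)).locallyIntegrableOn (s := univ) |>.mono_set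
        (subset_univ _) |> fun h => by
          refine (locallyIntegrableOn_iff isOpen_Ioi.isLocallyClosed).2 fun K hK hKc => ?_
          have := (locallyIntegrableOn_iff isOpen_Ioi.isLocallyClosed).1 h K hK hKc
          rwa [IntegrableOn, Measure.restrict_restrict hKc.measurableSet,
            inter_eq_left.2 hK] at this
    · intro g hg hc hs
      have h0 : ∫ x, g x • (w x - z x) = ∫ x in Ioi (0 : ℝ), g x • (w x - z x) := by
        refine (setIntegral_eq_integral_of_forall_compl_eq_zero fun x hx => ?_).symm
        rw [image_eq_zero_of_notMem_tsupport fun h => hx (hs h), zero_smul]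
      rw [h0]
      simp only [smul_sub]
      rw [integral_sub (integrable_test_smul hg.continuous hc w)
        (integrable_test_smul hg.continuous hc z), sub_eq_zero, ← neg_inj,
        ← hw g hg hc hs, ← hz g hg hc hs]
  refine Lp.ext ?_
  rw [EventuallyEq, ae_restrict_iff' measurableSet_Ioi]
  filter_upwards [key] with x hx h using sub_eq_zero.1 (hx h)

theorem MemH1.hasWeakDeriv {u : L2Half 𝕜} (h : MemH1 u) : HasWeakDeriv u (weakDeriv u) := by
  rw [weakDeriv, dif_pos h]; exact h.choose_spec

theorem HasWeakDeriv.weakDeriv_eq {u w : L2Half 𝕜} (h : HasWeakDeriv u w) : weakDeriv u = w :=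
  (MemH1.hasWeakDeriv ⟨w, h⟩).unique h

theorem MemH1.add {u v : L2Half 𝕜} (hu : MemH1 u) (hv : MemH1 v) : MemH1 (u + v) :=
  ⟨_, hu.hasWeakDeriv.add hv.hasWeakDeriv⟩

theorem MemH1.smul {u : L2Half 𝕜} (c : 𝕜) (hu : MemH1 u) : MemH1 (c • u) :=
  ⟨_, hu.hasWeakDeriv.smul c⟩

theorem weakDeriv_add {u v : L2Half 𝕜} (hu : MemH1 u) (hv : MemH1 v) :
    weakDeriv (u + v) = weakDeriv u + weakDeriv v :=
  (hu.hasWeakDeriv.add hv.hasWeakDeriv).weakDeriv_eq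

theorem weakDeriv_smul {u : L2Half 𝕜} (c : 𝕜) (hu : MemH1 u) :
    weakDeriv (c • u) = c • weakDeriv u :=
  (hu.hasWeakDeriv.smul c).weakDeriv_eq

theorem weakDeriv_zero : weakDeriv (0 : L2Half 𝕜) = 0 := HasWeakDeriv.zero.weakDeriv_eq

theorem MemH2.add {u v : L2Half 𝕜} (hu : MemH2 u) (hv : MemH2 v) : MemH2 (u + v) :=
  ⟨hu.1.add hv.1, by rw [weakDeriv_add hu.1 hv.1]; exact hu.2.add hv.2⟩

theorem MemH2.smul {u : L2Half 𝕜} (c : 𝕜) (hu : MemH2 u) : MemH2 (c • u) :=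
  ⟨hu.1.smul c, by rw [weakDeriv_smul c hu.1]; exact hu.2.smul c⟩

theorem HasValueAtZero.add {u v : L2Half 𝕜} {a b : 𝕜} (hu : HasValueAtZero u a)
    (hv : HasValueAtZero v b) : HasValueAtZero (u + v) (a + b) := by
  obtain ⟨f, hf, huf, rfl⟩ := hu
  obtain ⟨g, hg, hvg, rfl⟩ := hv
  exact ⟨f + g, hf.add hg, (Lp.coeFn_add u v).trans (huf.add hvg), rfl⟩

theorem HasValueAtZero.smul {u : L2Half 𝕜} {a : 𝕜} (c : 𝕜) (hu : HasValueAtZero u a) :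
    HasValueAtZero (c • u) (c * a) := by
  obtain ⟨f, hf, huf, rfl⟩ := hu
  exact ⟨c • f, hf.const_smul c, (Lp.coeFn_smul c u).trans (huf.const_smul c), rfl⟩

theorem HasValueAtZero.zero : HasValueAtZero (0 : L2Half 𝕜) 0 :=
  ⟨0, continuousOn_const, Lp.coeFn_zero 𝕜 2 halfLine, rfl⟩

/-- Boundary values are unique. -/
theorem HasValueAtZero.unique {u : L2Half 𝕜} {a b : 𝕜} (ha : HasValueAtZero u a)
    (hb : HasValueAtZero u b) : a = b := by
  obtain ⟨f, hf, huf, rfl⟩ := ha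
  obtain ⟨g, hg, hug, rfl⟩ := hb
  have h : f =ᵐ[volume.restrict (Ici (0 : ℝ))] g := by
    rw [← restrict_Ioi_eq_restrict_Ici]
    exact huf.symm.trans hug
  exact Measure.eqOn_of_ae_eq h hf hg (by simp) (mem_Ici.2 le_rfl)

theorem HasValueAtZero.valueAtZero_eq {u : L2Half 𝕜} {a : 𝕜} (h : HasValueAtZero u a) :
    valueAtZero u = a := by
  have h' : ∃ a : 𝕜, HasValueAtZero u a := ⟨a, h⟩
  rw [valueAtZero, dif_pos h']
  exact h'.choose_spec.unique h

end Facts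

/-! ## The star graph with `N` edges -/

/-- The Hilbert space `L²(𝒢) = ⨁ L²(ℝ₊)` (`N` summands), with its `ℓ²`-sum inner product. -/
abbrev L2Star (𝕜 : Type*) [RCLike 𝕜] (N : ℕ) : Type _ := PiLp 2 (fun _ : Fin N => L2Half 𝕜)

/-- The energy space `ℰ`: the `V ∈ H¹(𝒢)` with `v₁(0) = ⋯ = v_N(0)`. -/
def energySpace (𝕜 : Type*) [RCLike 𝕜] (N : ℕ) : Submodule 𝕜 (L2Star 𝕜 N) where
  carrier := {V | (∀ j, MemH1 (V j)) ∧ ∃ a : 𝕜, ∀ j, HasValueAtZero (V j) a}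
  add_mem' := by
    rintro U V ⟨hU, a, ha⟩ ⟨hV, b, hb⟩
    exact ⟨fun j => (hU j).add (hV j), a + b, fun j => (ha j).add (hb j)⟩
  zero_mem' := ⟨fun _ => ⟨0, HasWeakDeriv.zero⟩, 0, fun _ => HasValueAtZero.zero⟩
  smul_mem' := by
    rintro c U ⟨hU, a, ha⟩
    exact ⟨fun j => (hU j).smul c, c * a, fun j => (ha j).smul c⟩

/-- The domain `D_α`: the `V ∈ H²(𝒢)` with `v₁(0) = ⋯ = v_N(0)` (`= a` in the code) and
`∑ v_j'(0) = α v₁(0)`. -/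
def deltaDomain (𝕜 : Type*) [RCLike 𝕜] (N : ℕ) (α : ℝ) : Submodule 𝕜 (L2Star 𝕜 N) where
  carrier := {V | (∀ j, MemH2 (V j)) ∧ ∃ (a : 𝕜) (b : Fin N → 𝕜),
    (∀ j, HasValueAtZero (V j) a) ∧ (∀ j, HasValueAtZero (weakDeriv (V j)) (b j)) ∧
      ∑ j, b j = (α : 𝕜) * a}
  add_mem' := by
    rintro U V ⟨hU, a, b, ha, hb, hab⟩ ⟨hV, c, d, hc, hd, hcd⟩
    refine ⟨fun j => (hU j).add (hV j), a + c, b + d, fun j => (ha j).add (hc j), fun j => ?_, ?_⟩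
    · rw [PiLp.add_apply, weakDeriv_add (hU j).1 (hV j).1]
      exact (hb j).add (hd j)
    · simp only [Pi.add_apply, Finset.sum_add_distrib, hab, hcd, mul_add]
  zero_mem' := by
    refine ⟨fun _ => ⟨⟨0, HasWeakDeriv.zero⟩, ?_⟩, 0, 0, fun _ => HasValueAtZero.zero,
      fun _ => ?_, by simp⟩
    · rw [PiLp.zero_apply, weakDeriv_zero]; exact ⟨0, HasWeakDeriv.zero⟩
    · rw [PiLp.zero_apply, weakDeriv_zero]; exact HasValueAtZero.zero
  smul_mem' := by
    rintro c U ⟨hU, a, b, ha, hb, hab⟩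
    refine ⟨fun j => (hU j).smul c, c * a, c • b, fun j => (ha j).smul c, fun j => ?_, ?_⟩
    · rw [PiLp.smul_apply, weakDeriv_smul c (hU j).1]
      exact (hb j).smul c
    · simp only [Pi.smul_apply, smul_eq_mul, ← Finset.mul_sum, hab]
      ring

/-! ## The profiles and the forms -/

/-- The shift `a_k = artanh (α / ((2k - N) √ω))`. -/
def profileShift (N k : ℕ) (α ω : ℝ) : ℝ :=
  Real.artanh (α / ((2 * (k : ℝ) - N) * √ω))

/-- The profile `φ_{k,j}`; the edges `1, …, k` are the indices `j : Fin N` with `j < k`. -/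
def profile (N k : ℕ) (α ω p : ℝ) (j : Fin N) (x : ℝ) : ℝ :=
  ((p + 1) * ω / 2 *
    (1 / Real.cosh ((p - 1) * √ω / 2 * x +
      (if (j : ℕ) < k then - profileShift N k α ω else profileShift N k α ω))) ^ 2) ^ (1 / (p - 1))

/-- The form
`∑_j ∫_0^∞ (f_j' g_j' + ω f_j g_j - c φ_{k,j}^{p-1} f_j g_j) dx + α f_1(0) g_1(0)`, with complex
conjugation on the second argument if `𝕜 = ℂ`. -/
def form (𝕜 : Type*) [RCLike 𝕜] (N k : ℕ) [NeZero N] (α ω p c : ℝ) (F G : L2Star 𝕜 N) : 𝕜 :=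
  (∑ j, ∫ x in Ioi (0 : ℝ),
      (weakDeriv (F j) x * conj (weakDeriv (G j) x) + (ω : 𝕜) * (F j x * conj (G j x))
        - ((c * profile N k α ω p j x ^ (p - 1) : ℝ) : 𝕜) * (F j x * conj (G j x))))
    + (α : 𝕜) * (valueAtZero (F 0) * conj (valueAtZero (G 0)))

/-- The form `B^α_{1,k}` (on the domain `ℰ`). -/
def formB1 (𝕜 : Type*) [RCLike 𝕜] (N k : ℕ) [NeZero N] (α ω p : ℝ) :
    L2Star 𝕜 N → L2Star 𝕜 N → 𝕜 := form 𝕜 N k α ω p p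

/-- The form `B^α_{2,k}` (on the domain `ℰ`). -/
def formB2 (𝕜 : Type*) [RCLike 𝕜] (N k : ℕ) [NeZero N] (α ω p : ℝ) :
    L2Star 𝕜 N → L2Star 𝕜 N → 𝕜 := form 𝕜 N k α ω p 1

/-- `t` is a densely defined, symmetric (Hermitian), semibounded, closed sesquilinear form with
domain `D`. -/
structure IsClosedSemiboundedForm {𝕜 H : Type*} [RCLike 𝕜] [NormedAddCommGroup H]
    [InnerProductSpace 𝕜 H] (D : Submodule 𝕜 H) (t : H → H → 𝕜) : Prop where
  dense : Dense (D : Set H)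
  add_left : ∀ u ∈ D, ∀ v ∈ D, ∀ z ∈ D, t (u + v) z = t u z + t v z
  smul_left : ∀ (c : 𝕜), ∀ u ∈ D, ∀ z ∈ D, t (c • u) z = c * t u z
  symm : ∀ u ∈ D, ∀ v ∈ D, t v u = conj (t u v)
  bounded_below : ∃ γ : ℝ, ∀ u ∈ D, γ * ‖u‖ ^ 2 ≤ RCLike.re (t u u)
  closed : ∀ (u : ℕ → H) (v : H), (∀ n, u n ∈ D) → Tendsto u atTop (𝓝 v) →
    (∀ ε : ℝ, 0 < ε → ∃ n₀ : ℕ, ∀ m n : ℕ, n₀ ≤ m → n₀ ≤ n →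
      ‖t (u n - u m) (u n - u m)‖ < ε) →
    v ∈ D ∧ Tendsto (fun n => t (u n - v) (u n - v)) atTop (𝓝 0)

/-- `L` is the operator associated with the form `t` with domain `D`: its domain is
`{V ∈ D : ∃ W ∈ H, ∀ Z ∈ D, t(V, Z) = (W, Z)}`, and `L V = W`. The inner product
`(W, Z)`, linear in `W`, is `inner 𝕜 Z W`. -/
def IsAssociatedOperator {𝕜 H : Type*} [RCLike 𝕜] [NormedAddCommGroup H]
    [InnerProductSpace 𝕜 H] (D : Submodule 𝕜 H) (t : H → H → 𝕜) (L : H →ₗ.[𝕜] H) : Prop :=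
  (∀ V : H, V ∈ L.domain ↔ V ∈ D ∧ ∃ W : H, ∀ Z ∈ D, t V Z = inner 𝕜 Z W) ∧
    ∀ V : L.domain, ∀ Z ∈ D, t V Z = inner 𝕜 Z (L V)

/-! ## The diagonal Schrödinger operators -/

/-- Multiplication by a bounded real function on `L²(ℝ₊)`. -/
def mulBounded {𝕜 : Type*} [RCLike 𝕜] (q : ℝ → ℝ) (hq : MemLp q ∞ halfLine) :
    L2Half 𝕜 →ₗ[𝕜] L2Half 𝕜 where
  toFun u := MemLp.toLp (fun x => (q x : 𝕜) * u x) (MemLp.mul' (r := 2) (p := ∞) (q := 2) (Lp.memLp u) hq.ofReal)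
  map_add' u v := by
    refine Lp.ext ?_
    refine (MemLp.coeFn_toLp _).trans ?_
    filter_upwards [Lp.coeFn_add u v, Lp.coeFn_add (MemLp.toLp (fun x => (q x : 𝕜) * u x)
        (MemLp.mul' (r := 2) (p := ∞) (q := 2) (Lp.memLp u) hq.ofReal)) (MemLp.toLp (fun x => (q x : 𝕜) * v x)
        (MemLp.mul' (r := 2) (p := ∞) (q := 2) (Lp.memLp v) hq.ofReal)),
      MemLp.coeFn_toLp (MemLp.mul' (Lp.memLp u) (hq.ofReal (K := 𝕜)) (r := 2)),
      MemLp.coeFn_toLp (MemLp.mul' (Lp.memLp v) (hq.ofReal (K := 𝕜)) (r := 2))] with x h1 h2 h3 h4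
    rw [h2, Pi.add_apply, h3, h4, h1, Pi.add_apply, mul_add]
  map_smul' c u := by
    refine Lp.ext ?_
    refine (MemLp.coeFn_toLp _).trans ?_
    filter_upwards [Lp.coeFn_smul c u, Lp.coeFn_smul c (MemLp.toLp (fun x => (q x : 𝕜) * u x)
        (MemLp.mul' (r := 2) (p := ∞) (q := 2) (Lp.memLp u) hq.ofReal)),
      MemLp.coeFn_toLp (MemLp.mul' (Lp.memLp u) (hq.ofReal (K := 𝕜)) (r := 2))] with x h1 h2 h3
    rw [RingHom.id_apply, h2, Pi.smul_apply, h3, h1, Pi.smul_apply, smul_eq_mul, smul_eq_mul]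
    ring

/-- The potential `ω - c φ_{k,j}^{p-1}`. -/
def potential (N k : ℕ) (α ω p c : ℝ) (j : Fin N) (x : ℝ) : ℝ :=
  ω - c * profile N k α ω p j x ^ (p - 1)

theorem memLp_potential {N k : ℕ} {α ω p : ℝ} (c : ℝ) (hp : 1 < p)
    (hω : α ^ 2 / ((N : ℝ) - 2 * k) ^ 2 < ω) (j : Fin N) :
    MemLp (potential N k α ω p c j) ∞ halfLine := by
  have hω0 : 0 < ω := lt_of_le_of_lt (by positivity) hω
  have hp' : p - 1 ≠ 0 := by linarith
  have e : ∀ x, profile N k α ω p j x ^ (p - 1) = (p + 1) * ω / 2 *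
      (1 / Real.cosh ((p - 1) * √ω / 2 * x +
      (if (j : ℕ) < k then - profileShift N k α ω else profileShift N k α ω))) ^ 2 := by
    intro x
    rw [profile, ← Real.rpow_mul (by positivity), one_div_mul_cancel hp', Real.rpow_one]
  have hc : Continuous (potential N k α ω p c j) := by
    unfold potential
    simp only [e]
    have : ∀ y : ℝ, Real.cosh y ≠ 0 := fun y => (Real.cosh_pos y).ne'
    have hcosh := Real.continuous_cosh
    fun_prop (disch := simp [this])
  refine memLp_top_of_bound hc.aestronglyMeasurable (ω + |c| * ((p + 1) * ω / 2)) (.of_forall ?_)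
  intro x
  rw [potential, e, Real.norm_eq_abs]
  refine (abs_sub _ _).trans ?_
  rw [abs_of_pos hω0, abs_mul]
  gcongr
  rw [abs_of_nonneg (by positivity)]
  refine mul_le_of_le_one_right (by positivity) (pow_le_one₀ (by positivity) ?_)
  rw [div_le_one (Real.cosh_pos _)]
  exact Real.one_le_cosh _

/-- The diagonal operator `V ↦ (- v_j'' + q_j v_j)_j` with domain `D_α`, for bounded real
potentials `q_j`. -/
def schrodinger (𝕜 : Type*) [RCLike 𝕜] {N : ℕ} (α : ℝ) (q : Fin N → ℝ → ℝ)
    (hq : ∀ j, MemLp (q j) ∞ halfLine) : L2Star 𝕜 N →ₗ.[𝕜] L2Star 𝕜 N where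
  domain := deltaDomain 𝕜 N α
  toFun :=
    { toFun := fun V => WithLp.toLp 2 fun j =>
        - weakDeriv (weakDeriv (V.1 j)) + mulBounded (q j) (hq j) (V.1 j)
      map_add' := fun U V => by
        ext1 j
        simp only [Submodule.coe_add, PiLp.add_apply, map_add]
        rw [weakDeriv_add (U.2.1 j).1 (V.2.1 j).1, weakDeriv_add (U.2.1 j).2 (V.2.1 j).2]
        abel
      map_smul' := fun c U => by
        ext1 j
        simp only [Submodule.coe_smul, PiLp.smul_apply, map_smul, RingHom.id_apply, smul_add,
          smul_neg]
        rw [weakDeriv_smul c (U.2.1 j).1, weakDeriv_smul c (U.2.1 j).2] }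

end StarGraph

end

/-! The potential `ω - c φ^{p-1}` is bounded, since `φ^{p-1}` is a constant times `sech²`; the
profiles enter in no other way. So it suffices to treat `(F', G') + (q F, G) + α F(0) conj G(0)`
with bounded real `q_j`, which is `robinForm`.

Integrating `(|u|²)'` gives the trace inequality `|u(0)|² ≤ 2 ‖u‖ ‖u'‖`, which makes the vertex term
small relative to `‖F'‖²`, up to a multiple of `‖F‖²`. Hence a suitable shift of the form is
equivalent to the squared `H¹` norm (`exists_robinForm_bounds`). Semiboundedness follows, and so
does closedness, as the weak derivative is closed and traces pass to `H¹` limits.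

Self-adjointness is abstract: Riesz representation in the form norm makes `L + c` onto for some real
`c`, and a symmetric operator with this property is self-adjoint
(`IsClosedSemiboundedForm.isSelfAdjoint`).

The domain is found by testing. Test functions on a single edge give `V_j'' = q_j V_j - W_j` weakly,
so `V` is `H²`. Integration by parts then leaves only `(α V(0) - ∑ V_j'(0)) conj Z(0)`, and one `Z`
with `Z(0) = 1` forces the vertex condition. The calculus behind this is the du Bois-Reymond lemma
(`HasWeakDeriv.exists_isPrimitive`) and the product rule for absolutely continuous functions
(`IsPrimitive.mul`). -/

noncomputable section

namespace StarGraph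

/-! ## Closed semibounded forms and their associated operators -/

section Forms

variable {𝕜 H : Type*} [RCLike 𝕜] [NormedAddCommGroup H] [InnerProductSpace 𝕜 H]
  {D : Submodule 𝕜 H} {t : H → H → 𝕜}

/-- The domain of a form as a bare vector space, without the norm induced by the ambient space. -/
def FormDomain (D : Submodule 𝕜 H) : Type _ := D

instance : AddCommGroup (FormDomain D) := inferInstanceAs (AddCommGroup D)

instance : Module 𝕜 (FormDomain D) := inferInstanceAs (Module 𝕜 D)

/-- The inclusion of the form domain into the ambient space. -/
def FormDomain.incl (D : Submodule 𝕜 H) : FormDomain D →ₗ[𝕜] H := D.subtype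

/-- An element of the form domain. -/
def FormDomain.mk (v : H) (hv : v ∈ D) : FormDomain D := (⟨v, hv⟩ : D)

theorem FormDomain.incl_mk {v : H} (hv : v ∈ D) : FormDomain.incl D (FormDomain.mk v hv) = v := rfl

theorem FormDomain.incl_mem (u : FormDomain D) : FormDomain.incl D u ∈ D := u.2

theorem FormDomain.incl_injective : Function.Injective (FormDomain.incl D) :=
  Subtype.val_injective

/-- The inner product `(x, y) ↦ t(y, x) + c (y, x)` on the form domain. -/
abbrev IsClosedSemiboundedForm.core (ht : IsClosedSemiboundedForm D t) (c : ℝ)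
    (hc : ∀ u ∈ D, ‖u‖ ^ 2 ≤ RCLike.re (t u u) + c * ‖u‖ ^ 2) :
    InnerProductSpace.Core 𝕜 (FormDomain D) where
  -- The arguments are swapped because `t` is linear in the first one, whereas `inner 𝕜` is linear
  -- in the second.
  inner x y := t (FormDomain.incl D y) (FormDomain.incl D x)
    + (c : 𝕜) * inner 𝕜 (FormDomain.incl D x) (FormDomain.incl D y)
  conj_inner_symm x y := by
    rw [map_add, map_mul, inner_conj_symm, RCLike.conj_ofReal,
      ← ht.symm _ x.incl_mem _ y.incl_mem]
  re_inner_nonneg x := by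
    rw [map_add, RCLike.re_ofReal_mul, inner_self_eq_norm_sq]
    exact (sq_nonneg _).trans (hc _ x.incl_mem)
  add_left x y z := by
    rw [map_add, ht.symm _ (D.add_mem x.incl_mem y.incl_mem) _ z.incl_mem,
      ht.add_left _ x.incl_mem _ y.incl_mem _ z.incl_mem, map_add,
      ← ht.symm _ x.incl_mem _ z.incl_mem, ← ht.symm _ y.incl_mem _ z.incl_mem, inner_add_left]
    ring
  smul_left x y r := by
    rw [map_smul, ht.symm _ (D.smul_mem r x.incl_mem) _ y.incl_mem,
      ht.smul_left _ _ x.incl_mem _ y.incl_mem, map_mul,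
      ← ht.symm _ x.incl_mem _ y.incl_mem, inner_smul_left]
    ring
  definite x h := by
    have h1 := congrArg RCLike.re h
    rw [map_add, RCLike.re_ofReal_mul, inner_self_eq_norm_sq, map_zero] at h1
    have h2 : ‖FormDomain.incl D x‖ ^ 2 ≤ 0 := (hc _ x.incl_mem).trans h1.le
    refine FormDomain.incl_injective ?_
    rw [map_zero]
    exact norm_eq_zero.1 (pow_eq_zero_iff two_ne_zero |>.1 (le_antisymm h2 (sq_nonneg _)))

/-- If the shifted form `t + c` is coercive, then it represents every vector of the space. -/
theorem IsClosedSemiboundedForm.exists_represents [CompleteSpace H]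
    (ht : IsClosedSemiboundedForm D t) (c : ℝ)
    (hc : ∀ u ∈ D, ‖u‖ ^ 2 ≤ RCLike.re (t u u) + c * ‖u‖ ^ 2) (g : H) :
    ∃ u ∈ D, ∀ z ∈ D, t u z + (c : 𝕜) * inner 𝕜 z u = inner 𝕜 z g := by
  let _ : NormedAddCommGroup (FormDomain D) := (ht.core c hc).toNormedAddCommGroup
  let _ : InnerProductSpace 𝕜 (FormDomain D) := InnerProductSpace.ofCore (ht.core c hc).toCore
  have hinner (x y : FormDomain D) : inner 𝕜 x y = t (FormDomain.incl D y) (FormDomain.incl D x)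
    + (c : 𝕜) * inner 𝕜 (FormDomain.incl D x) (FormDomain.incl D y) := rfl
  have hnorm (x : FormDomain D) : ‖x‖ ^ 2 = RCLike.re (t (FormDomain.incl D x) (FormDomain.incl D x))
      + c * ‖FormDomain.incl D x‖ ^ 2 := by
    rw [← inner_self_eq_norm_sq (𝕜 := 𝕜), hinner, map_add, RCLike.re_ofReal_mul,
      inner_self_eq_norm_sq]
  have hle (x : FormDomain D) : ‖FormDomain.incl D x‖ ≤ ‖x‖ := by
    refine le_of_sq_le_sq ?_ (norm_nonneg _)
    rw [hnorm]
    exact hc _ x.incl_mem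
  -- Symmetry makes `t x x` real, so its modulus, which closedness is phrased with, is controlled by
  -- the form norm.
  have hreal (x : FormDomain D) : ‖t (FormDomain.incl D x) (FormDomain.incl D x)‖
      ≤ (1 + |c|) * ‖x‖ ^ 2 := by
    have h1 : t (FormDomain.incl D x) (FormDomain.incl D x)
        = (RCLike.re (t (FormDomain.incl D x) (FormDomain.incl D x)) : 𝕜) :=
      (RCLike.conj_eq_iff_re.1 (ht.symm _ x.incl_mem _ x.incl_mem).symm).symm
    rw [h1, RCLike.norm_ofReal, eq_sub_of_add_eq (hnorm x).symm]
    refine (abs_sub _ _).trans ?_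
    rw [abs_mul, abs_of_nonneg (sq_nonneg ‖x‖), abs_of_nonneg (sq_nonneg ‖FormDomain.incl D x‖), add_mul, one_mul]
    gcongr
    exact hle x
  -- A form-Cauchy sequence converges in `H`; closedness puts the limit in `D` and upgrades the
  -- convergence to the form norm.
  have : CompleteSpace (FormDomain D) := by
    refine Metric.complete_of_cauchySeq_tendsto fun u hu => ?_
    have hu' := Metric.cauchySeq_iff.1 hu
    have hcau : CauchySeq fun n => FormDomain.incl D (u n) := by
      refine Metric.cauchySeq_iff.2 fun ε hε => ?_
      obtain ⟨n₀, h⟩ := hu' ε hε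
      refine ⟨n₀, fun m hm n hn => lt_of_le_of_lt ?_ (h m hm n hn)⟩
      rw [dist_eq_norm, dist_eq_norm, ← map_sub]
      exact hle _
    obtain ⟨v, hv⟩ := cauchySeq_tendsto_of_complete hcau
    obtain ⟨hvD, hlim⟩ := ht.closed _ v (fun n => (u n).incl_mem) hv fun ε hε => by
      obtain ⟨n₀, h⟩ := hu' (√(ε / (1 + |c|))) (by positivity)
      refine ⟨n₀, fun m n hm hn => ?_⟩
      rw [← map_sub]
      refine (hreal _).trans_lt ?_
      have h1 : ‖u n - u m‖ ^ 2 < ε / (1 + |c|) := by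
        rw [← Real.lt_sqrt (norm_nonneg _), ← dist_eq_norm]
        exact h n hn m hm
      rwa [lt_div_iff₀' (by positivity)] at h1
    refine ⟨FormDomain.mk v hvD, ?_⟩
    rw [tendsto_iff_norm_sub_tendsto_zero]
    have hsq : Tendsto (fun n => ‖u n - FormDomain.mk v hvD‖ ^ 2) atTop (𝓝 0) := by
      simp only [hnorm, map_sub, FormDomain.incl_mk]
      have h1 := (RCLike.continuous_re.tendsto _).comp hlim
      have h2 := ((tendsto_iff_norm_sub_tendsto_zero.1 hv).pow 2).const_mul c
      simpa using h1.add h2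
    simpa using hsq.sqrt
  -- Riesz representation of `z ↦ (z, g)`, which is bounded in the form norm because that norm
  -- dominates the norm of `H`.
  let ℓ : FormDomain D →L[𝕜] 𝕜 := LinearMap.mkContinuous
    ((innerSL 𝕜 g).toLinearMap ∘ₗ FormDomain.incl D) ‖g‖ fun x => by
      refine (norm_inner_le_norm g _).trans ?_
      gcongr
      exact hle x
  let u := (InnerProductSpace.toDual 𝕜 (FormDomain D)).symm ℓ
  refine ⟨FormDomain.incl D u, u.incl_mem, fun z hz => ?_⟩
  have h := InnerProductSpace.toDual_symm_apply (x := FormDomain.mk z hz) (y := ℓ)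
  rw [hinner] at h
  change t z (FormDomain.incl D u) + c * inner 𝕜 (FormDomain.incl D u) z = inner 𝕜 g z at h
  rw [← inner_conj_symm z g, ← h, map_add, map_mul, RCLike.conj_ofReal, inner_conj_symm,
    ← ht.symm z hz _ u.incl_mem]

theorem IsClosedSemiboundedForm.exists_coercive_shift (ht : IsClosedSemiboundedForm D t) :
    ∃ c : ℝ, ∀ u ∈ D, ‖u‖ ^ 2 ≤ RCLike.re (t u u) + c * ‖u‖ ^ 2 := by
  obtain ⟨γ, hγ⟩ := ht.bounded_below
  exact ⟨1 - γ, fun u hu => by linarith [hγ u hu]⟩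

/-- An operator associated with a form with dense domain is unique. -/
theorem IsAssociatedOperator.unique (hD : Dense (D : Set H)) {L M : H →ₗ.[𝕜] H}
    (hL : IsAssociatedOperator D t L) (hM : IsAssociatedOperator D t M) : L = M := by
  refine LinearPMap.ext (Submodule.ext fun V => (hL.1 V).trans (hM.1 V).symm) fun V h h' => ?_
  refine hD.eq_of_inner_left 𝕜 fun Z hZ => ?_
  rw [← inner_conj_symm, ← inner_conj_symm (M _)]
  exact congrArg _ ((hL.2 ⟨V, h⟩ Z hZ).symm.trans (hM.2 ⟨V, h'⟩ Z hZ))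

/-- The operator associated with a closed semibounded form is self-adjoint. -/
theorem IsClosedSemiboundedForm.isSelfAdjoint [CompleteSpace H]
    (ht : IsClosedSemiboundedForm D t) {L : H →ₗ.[𝕜] H} (hL : IsAssociatedOperator D t L) :
    IsSelfAdjoint L := by
  obtain ⟨c, hc⟩ := ht.exists_coercive_shift
  have hLD (V : L.domain) : (V : H) ∈ D := ((hL.1 V).1 V.2).1
  have hsymm (U V : L.domain) : inner 𝕜 (L U) (V : H) = inner 𝕜 (U : H) (L V) := by
    rw [← inner_conj_symm, ← hL.2 U V (hLD V), ← hL.2 V U (hLD U), ← ht.symm _ (hLD U) _ (hLD V)]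
  -- Closedness of the form enters here only, through the Riesz argument.
  have hsurj (g : H) : ∃ U : L.domain, L U + (c : 𝕜) • (U : H) = g := by
    obtain ⟨u, hu, h⟩ := ht.exists_represents c hc g
    have hdom : u ∈ L.domain := (hL.1 u).2 ⟨hu, g - (c : 𝕜) • u, fun z hz => by
      rw [inner_sub_right, inner_smul_right, ← h z hz, add_sub_cancel_right]⟩
    refine ⟨⟨u, hdom⟩, ht.dense.eq_of_inner_right 𝕜 fun z hz => ?_⟩
    rw [inner_add_right, inner_smul_right, ← hL.2 ⟨u, hdom⟩ z hz, h z hz]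
  -- If `h = (L + c) U` is orthogonal to the domain, pairing with `U` gives `t(U, U) + c ‖U‖² = 0`,
  -- and coercivity forces `U = 0`.
  have hdense : Dense (L.domain : Set H) := by
    rw [Submodule.dense_iff_topologicalClosure_eq_top, Submodule.topologicalClosure_eq_top_iff,
      Submodule.eq_bot_iff]
    intro h hh
    obtain ⟨U, hU⟩ := hsurj h
    have h0 : inner 𝕜 (U : H) h = 0 := (Submodule.mem_orthogonal _ _).1 hh U U.2
    rw [← hU, inner_add_right, inner_smul_right, ← hL.2 U U (hLD U)] at h0
    have h1 := congrArg RCLike.re h0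
    rw [map_add, RCLike.re_ofReal_mul, inner_self_eq_norm_sq, map_zero] at h1
    have hU0 : U = 0 := by
      have h2 : ‖(U : H)‖ ^ 2 ≤ 0 := (hc _ (hLD U)).trans h1.le
      exact Subtype.ext
        (norm_eq_zero.1 (pow_eq_zero_iff two_ne_zero |>.1 (le_antisymm h2 (sq_nonneg _))))
    rw [← hU, hU0, LinearPMap.map_zero, Submodule.coe_zero, smul_zero, add_zero]
  rw [LinearPMap.isSelfAdjoint_def]
  have hle : L ≤ L.adjoint :=
    LinearPMap.IsFormalAdjoint.le_adjoint hdense fun U V => hsymm U V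
  refine (LinearPMap.eq_of_le_of_domain_eq hle (le_antisymm hle.1 fun V hV => ?_)).symm
  -- For `V` in the domain of the adjoint, solve `(L + c) U = (L* + c) V` with `U` in the domain of
  -- `L`. Then `U - V` is orthogonal to the range of `L + c`, which is everything, so `V = U`.
  obtain ⟨U, hU⟩ := hsurj (L.adjoint ⟨V, hV⟩ + (c : 𝕜) • V)
  have hUV : (U : H) = V := by
    rw [← sub_eq_zero]
    obtain ⟨Z, hZ⟩ := hsurj ((U : H) - V)
    have hadj := LinearPMap.adjoint_isFormalAdjoint hdense ⟨V, hV⟩ Z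
    have h1 : inner 𝕜 ((U : H) - V) (L Z + (c : 𝕜) • (Z : H)) = 0 := by
      have h2 : inner 𝕜 (L U + (c : 𝕜) • (U : H)) (Z : H)
          = inner 𝕜 (L.adjoint ⟨V, hV⟩ + (c : 𝕜) • V) (Z : H) := by rw [hU]
      rw [inner_add_left, inner_add_left, inner_smul_left, inner_smul_left, RCLike.conj_ofReal,
        hsymm, hadj] at h2
      rw [inner_add_right, inner_smul_right, inner_sub_left, inner_sub_left]
      linear_combination h2
    rw [hZ] at h1
    exact inner_self_eq_zero.1 h1
  exact hUV ▸ U.2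

end Forms

end StarGraph

end

noncomputable section

namespace StarGraph

/-! ## Primitives of locally integrable functions on the half-line -/

/-- Increments of the integral of `w` are bounded by those of the integral of `‖w‖`, which reduces
the claim to the real-valued case. -/
theorem _root_.IntervalIntegrable.absolutelyContinuousOnInterval_integral {E : Type*}
    [NormedAddCommGroup E] [NormedSpace ℝ E] {w : ℝ → E} {a b : ℝ}
    (h : IntervalIntegrable w volume a b) :
    AbsolutelyContinuousOnInterval (fun x => ∫ t in a..x, w t) a b := by
  have hn := h.norm.absolutelyContinuousOnInterval_intervalIntegral left_mem_uIcc
  rw [absolutelyContinuousOnInterval_iff] at hn ⊢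
  intro ε hε
  obtain ⟨δ, hδ, H⟩ := hn ε hε
  refine ⟨δ, hδ, fun I hI hI' => (Finset.sum_le_sum fun i hi => ?_).trans_lt (H I hI hI')⟩
  obtain ⟨h1, h2⟩ := hI.1 i hi
  have i1 : IntervalIntegrable w volume a (I.2 i).1 :=
    h.mono_set (uIcc_subset_uIcc left_mem_uIcc h1)
  have i2 : IntervalIntegrable w volume a (I.2 i).2 :=
    h.mono_set (uIcc_subset_uIcc left_mem_uIcc h2)
  rw [dist_eq_norm, dist_eq_norm, intervalIntegral.integral_interval_sub_left i1 i2,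
    intervalIntegral.integral_interval_sub_left i1.norm i2.norm, Real.norm_eq_abs]
  exact intervalIntegral.norm_integral_le_abs_integral_norm

variable {𝕜 : Type*} [RCLike 𝕜]

/-- On `[0, ∞)`, the function `f` is a primitive of the locally integrable function `w`. -/
structure IsPrimitive (f w : ℝ → 𝕜) : Prop where
  intervalIntegrable : ∀ R : ℝ, 0 ≤ R → IntervalIntegrable w volume 0 R
  eq_add_integral : ∀ x : ℝ, 0 ≤ x → f x = f 0 + ∫ t in (0 : ℝ)..x, w t

theorem IsPrimitive.absolutelyContinuousOnInterval {f w : ℝ → 𝕜} (h : IsPrimitive f w) {R : ℝ}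
    (hR : 0 ≤ R) : AbsolutelyContinuousOnInterval f 0 R := by
  have h1 := (h.intervalIntegrable R hR).absolutelyContinuousOnInterval_integral
  rw [absolutelyContinuousOnInterval_iff] at h1 ⊢
  intro ε hε
  obtain ⟨δ, hδ, H⟩ := h1 ε hε
  refine ⟨δ, hδ, fun I hI hI' => (Finset.sum_le_sum fun i hi => ?_).trans_lt (H I hI hI')⟩
  obtain ⟨h1, h2⟩ := hI.1 i hi
  rw [uIcc_of_le hR] at h1 h2
  rw [h.eq_add_integral _ h1.1, h.eq_add_integral _ h2.1, dist_add_left]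

theorem IsPrimitive.continuousOn {f w : ℝ → 𝕜} (h : IsPrimitive f w) :
    ContinuousOn f (Ici 0) := by
  intro x hx
  have hx' : (0 : ℝ) ≤ x := hx
  have h1 := (h.absolutelyContinuousOnInterval (R := x + 1) (by linarith)).continuousOn
  rw [uIcc_of_le (by linarith)] at h1
  refine (h1 x ⟨hx', by linarith⟩).mono_of_mem_nhdsWithin ?_
  rw [← Ici_inter_Iic]
  exact inter_mem_nhdsWithin _ (Iic_mem_nhds (by linarith))

/-- This is Lebesgue differentiation. The open interval is needed since `f` is an integral only on
`[0, ∞)`, while the derivative is two-sided. -/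
theorem IsPrimitive.ae_hasDerivAt {f w : ℝ → 𝕜} (h : IsPrimitive f w) {R : ℝ} (hR : 0 ≤ R) :
    ∀ᵐ x, x ∈ Ioo 0 R → HasDerivAt f (w x) x := by
  filter_upwards [(h.intervalIntegrable R hR).ae_hasDerivAt_integral] with x hx hxR
  have h1 := (hx (by rw [uIcc_of_le hR]; exact Ioo_subset_Icc_self hxR) 0 left_mem_uIcc).const_add
    (f 0)
  refine h1.congr_of_eventuallyEq ?_
  filter_upwards [Ioi_mem_nhds hxR.1] with y hy using h.eq_add_integral y (le_of_lt hy)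

theorem ae_Ioo_of_mem_uIcc {R : ℝ} (hR : 0 ≤ R) : ∀ᵐ x : ℝ, x ∈ uIcc 0 R → x ∈ Ioo 0 R := by
  filter_upwards [Measure.ae_ne volume (0 : ℝ), Measure.ae_ne volume R] with x h1 h2 h3
  rw [uIcc_of_le hR] at h3
  exact ⟨lt_of_le_of_ne h3.1 h1.symm, lt_of_le_of_ne h3.2 h2⟩

/-- The product rule for primitives. -/
theorem IsPrimitive.mul {f g w z : ℝ → 𝕜} (hf : IsPrimitive f w) (hg : IsPrimitive g z) :
    IsPrimitive (fun x => f x * g x) (fun x => w x * g x + f x * z x) := by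
  have hprod (R : ℝ) (hR : 0 ≤ R) :
      IntervalIntegrable (fun x => w x * g x + f x * z x) volume 0 R :=
    ((hf.intervalIntegrable R hR).mul_continuousOn
      (hg.absolutelyContinuousOnInterval hR).continuousOn).add
      ((hg.intervalIntegrable R hR).continuousOn_mul
      (hf.absolutelyContinuousOnInterval hR).continuousOn)
  refine ⟨hprod, fun R hR => ?_⟩
  -- The difference of the two sides is absolutely continuous with derivative zero almost
  -- everywhere, hence constant.
  have hac : AbsolutelyContinuousOnInterval
      (fun x => f x * g x - ∫ t in (0 : ℝ)..x, (w t * g t + f t * z t)) 0 R :=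
    ((hf.absolutelyContinuousOnInterval hR).smul
      (hg.absolutelyContinuousOnInterval hR)).sub (hprod R hR).absolutelyContinuousOnInterval_integral
  obtain ⟨C, hC⟩ := hac.const_of_ae_hasDerivAt_zero (by
    filter_upwards [ae_Ioo_of_mem_uIcc hR, hf.ae_hasDerivAt hR, hg.ae_hasDerivAt hR,
      (hprod R hR).ae_hasDerivAt_integral] with x hx h1 h2 h3 hxR
    have h4 := ((h1 (hx hxR)).mul (h2 (hx hxR))).sub (h3 hxR 0 left_mem_uIcc)
    rwa [sub_self] at h4)
  have h0 := hC 0 left_mem_uIcc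
  have h1 := hC R right_mem_uIcc
  simp only [intervalIntegral.integral_same, sub_zero] at h0
  rw [h0, ← h1]
  ring

theorem IsPrimitive.conj {f w : ℝ → 𝕜} (h : IsPrimitive f w) :
    IsPrimitive (fun x => conj (f x)) (fun x => conj (w x)) := by
  refine ⟨fun R hR => ?_, fun x hx => ?_⟩
  · have := h.intervalIntegrable R hR
    rw [intervalIntegrable_iff] at this ⊢
    exact (RCLike.conjLIE (K := 𝕜)).toContinuousLinearEquiv.toContinuousLinearMap.integrable_comp
      this
  · have h1 : ∫ t in (0 : ℝ)..x, conj (w t) = conj (∫ t in (0 : ℝ)..x, w t) := by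
      simp only [intervalIntegral, integral_conj, map_sub]
    rw [h1, ← map_add, ← h.eq_add_integral x hx]

theorem isPrimitive_of_hasDerivAt {f w : ℝ → 𝕜} (hw : Continuous w)
    (h : ∀ x, HasDerivAt f (w x) x) : IsPrimitive f w where
  intervalIntegrable R _ := hw.intervalIntegrable 0 R
  eq_add_integral x _ := by
    rw [intervalIntegral.integral_eq_sub_of_hasDerivAt (fun y _ => h y)
      (hw.intervalIntegrable 0 x)]
    ring

/-- An integrable function on the half-line with integrable derivative `w` satisfies
`∫ w = - f(0)`. -/
theorem IsPrimitive.integral_eq {f w : ℝ → 𝕜} (h : IsPrimitive f w)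
    (hf : IntegrableOn f (Ioi 0)) (hw : IntegrableOn w (Ioi 0)) :
    ∫ x in Ioi (0 : ℝ), w x = - f 0 := by
  have h1 := (intervalIntegral_tendsto_integral_Ioi 0 hw tendsto_id).const_add (f 0)
  have h2 : Tendsto f atTop (𝓝 (f 0 + ∫ x in Ioi (0 : ℝ), w x)) := by
    refine h1.congr' ?_
    filter_upwards [eventually_ge_atTop 0] with x hx using (h.eq_add_integral x hx).symm
  -- `f` has a limit at infinity because `w` is integrable; integrability of `f` itself forces that
  -- limit to be `0`.
  have h3 : IntegrableAtFilter f atTop volume := ⟨Ioi 0, Ioi_mem_atTop 0, hf⟩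
  have h4 := h3.eq_zero_of_tendsto (fun s hs => by
    obtain ⟨a, ha⟩ := mem_atTop_sets.1 hs
    exact top_unique (Real.volume_Ici (a := a) ▸ measure_mono ha)) h2
  exact (neg_eq_of_add_eq_zero_right h4).symm

/-! ## Sobolev functions on the half-line -/

theorem intervalIntegrable_coe (w : L2Half 𝕜) (R : ℝ) (hR : 0 ≤ R) :
    IntervalIntegrable w volume 0 R := by
  rw [intervalIntegrable_iff_integrableOn_Ioc_of_le hR]
  have h1 : MemLp w 2 (volume.restrict (Ioc 0 R)) :=
    (Lp.memLp w).mono_measure (Measure.restrict_mono_set _ Ioc_subset_Ioi_self)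
  exact h1.integrable (by norm_num)

theorem isPrimitive_integral (w : L2Half 𝕜) (a : 𝕜) :
    IsPrimitive (fun x => a + ∫ t in (0 : ℝ)..x, w t) w :=
  ⟨intervalIntegrable_coe w, fun x _ => by simp⟩

theorem _root_.HasDerivAt.rclike_ofReal {f : ℝ → ℝ} {f' x : ℝ} (h : HasDerivAt f f' x) :
    HasDerivAt (fun y => (f y : 𝕜)) (f' : 𝕜) x :=
  (RCLike.ofRealCLM (K := 𝕜)).hasFDerivAt.comp_hasDerivAt x h

theorem isPrimitive_test {φ : ℝ → ℝ} (hφ : ContDiff ℝ (⊤ : ℕ∞) φ) :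
    IsPrimitive (fun x => (φ x : 𝕜)) (fun x => ((deriv φ x : ℝ) : 𝕜)) :=
  isPrimitive_of_hasDerivAt (RCLike.continuous_ofReal.comp (hφ.continuous_deriv (by simp)))
    fun x => ((hφ.differentiable (by simp)) x).hasDerivAt.rclike_ofReal

/-- Integration by parts against test functions. -/
theorem IsPrimitive.integral_deriv_smul {f w : ℝ → 𝕜} (h : IsPrimitive f w) {φ : ℝ → ℝ}
    (hφ : ContDiff ℝ (⊤ : ℕ∞) φ) (hc : HasCompactSupport φ) (hs : tsupport φ ⊆ Ioi (0 : ℝ)) :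
    IntegrableOn (fun x => deriv φ x • f x) (Ioi 0) ∧ IntegrableOn (fun x => φ x • w x) (Ioi 0) ∧
    ∫ x in Ioi (0 : ℝ), deriv φ x • f x = - ∫ x in Ioi (0 : ℝ), φ x • w x := by
  obtain ⟨R, hR⟩ := hc.isCompact.bddAbove
  have hφ0 (x : ℝ) (hx : max R 0 < x) : φ x = 0 :=
    image_eq_zero_of_notMem_tsupport fun h' => (hR h').not_gt ((le_max_left _ _).trans_lt hx)
  have hφ' (x : ℝ) (hx : max R 0 < x) : deriv φ x = 0 :=
    image_eq_zero_of_notMem_tsupport fun h' =>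
      (hR (tsupport_deriv_subset h')).not_gt ((le_max_left _ _).trans_lt hx)
  have hR0 : 0 ≤ max R 0 := le_max_right _ _
  have key {F : ℝ → 𝕜} (hF : IntervalIntegrable F volume 0 (max R 0))
      (hF0 : ∀ x, max R 0 < x → F x = 0) : IntegrableOn F (Ioi 0) := by
    rw [← Ioc_union_Ioi_eq_Ioi hR0]
    refine ((intervalIntegrable_iff_integrableOn_Ioc_of_le hR0).1 hF).union ?_
    exact integrableOn_zero.congr_fun (fun x hx => (hF0 x hx).symm) measurableSet_Ioi
  have hprim := (isPrimitive_test (𝕜 := 𝕜) hφ)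
  have hfc := (h.absolutelyContinuousOnInterval hR0).continuousOn
  have hφc : Continuous fun x => (φ x : 𝕜) := RCLike.continuous_ofReal.comp hφ.continuous
  have i1 : IntegrableOn (fun x => ((deriv φ x : ℝ) : 𝕜) * f x) (Ioi 0) :=
    key ((hprim.intervalIntegrable _ hR0).mul_continuousOn hfc)
      fun x hx => by simp [hφ' x hx]
  have i2 : IntegrableOn (fun x => (φ x : 𝕜) * w x) (Ioi 0) :=
    key ((h.intervalIntegrable _ hR0).continuousOn_mul hφc.continuousOn)
      fun x hx => by simp [hφ0 x hx]
  have i3 : IntegrableOn (fun x => (φ x : 𝕜) * f x) (Ioi 0) :=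
    key (hφc.continuousOn.mul hfc).intervalIntegrable fun x hx => by simp [hφ0 x hx]
  have h0 : φ 0 = 0 := image_eq_zero_of_notMem_tsupport fun h' => lt_irrefl (0 : ℝ) (hs h')
  -- The product `φ f` vanishes at `0`, so its derivative has integral zero.
  have h1 := (hprim.mul h).integral_eq i3 (i1.add i2)
  simp only [RCLike.real_smul_eq_coe_mul]
  refine ⟨i1, i2, ?_⟩
  rw [integral_add i1 i2, h0, RCLike.ofReal_zero, zero_mul, neg_zero] at h1
  exact eq_neg_of_add_eq_zero_left h1

theorem IsPrimitive.hasWeakDeriv {u w : L2Half 𝕜} {f g : ℝ → 𝕜} (h : IsPrimitive f g)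
    (hf : u =ᵐ[halfLine] f) (hg : w =ᵐ[halfLine] g) : HasWeakDeriv u w := by
  intro φ hφ hc hs
  have h1 : ∫ x in Ioi (0 : ℝ), deriv φ x • u x = ∫ x in Ioi (0 : ℝ), deriv φ x • f x :=
    integral_congr_ae (by filter_upwards [hf] with x hx; rw [hx])
  have h2 : ∫ x in Ioi (0 : ℝ), φ x • w x = ∫ x in Ioi (0 : ℝ), φ x • g x :=
    integral_congr_ae (by filter_upwards [hg] with x hx; rw [hx])
  rw [h1, h2, (h.integral_deriv_smul hφ hc hs).2.2]

/-- A test function on `(0, ∞)` with vanishing integral is the derivative of a test function. -/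
theorem exists_test_primitive {g : ℝ → ℝ} (hg : ContDiff ℝ (⊤ : ℕ∞) g) (hc : HasCompactSupport g)
    (hs : tsupport g ⊆ Ioi (0 : ℝ)) (h0 : ∫ x, g x = 0) :
    ∃ ψ : ℝ → ℝ, ContDiff ℝ (⊤ : ℕ∞) ψ ∧ HasCompactSupport ψ ∧ tsupport ψ ⊆ Ioi (0 : ℝ) ∧
      deriv ψ = g := by
  obtain ⟨b, hb⟩ := hc.isCompact.bddAbove
  -- Compactness keeps the support of `g` at a positive distance from `0`; the primitive inherits
  -- the bound `a`.
  obtain ⟨a, ha0, ha⟩ : ∃ a : ℝ, 0 < a ∧ tsupport g ⊆ Ici a := by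
    rcases (tsupport g).eq_empty_or_nonempty with h | h
    · exact ⟨1, one_pos, by simp [h]⟩
    · obtain ⟨a, ha, ha'⟩ := hc.isCompact.exists_isLeast h
      exact ⟨a, hs ha, ha'⟩
  have hd (x : ℝ) : HasDerivAt (fun x => ∫ t in (0 : ℝ)..x, g t) (g x) x :=
    intervalIntegral.integral_hasDerivAt_right (hg.continuous.intervalIntegrable _ _)
      hg.continuous.stronglyMeasurable.stronglyMeasurableAtFilter hg.continuous.continuousAt
  have hderiv : deriv (fun x => ∫ t in (0 : ℝ)..x, g t) = g := funext fun x => (hd x).deriv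
  -- Left of `a` the integrand vanishes throughout; right of `b` the primitive equals the total
  -- integral, which is zero.
  have hsub : tsupport (fun x => ∫ t in (0 : ℝ)..x, g t) ⊆ Icc a b := by
    refine closure_minimal (fun x hx => ?_) isClosed_Icc
    by_contra hxab
    refine hx ?_
    rcases lt_or_ge x a with hxa | hxa
    · refine intervalIntegral.integral_zero_ae (.of_forall fun t ht => ?_)
      refine image_eq_zero_of_notMem_tsupport fun h' => ?_
      have h1 : t ≤ max 0 x := (mem_uIoc.1 ht).elim (fun h => h.2.trans (le_max_right _ _))
        fun h => h.2.trans (le_max_left _ _)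
      exact (h1.trans_lt (max_lt ha0 hxa)).not_ge (ha h')
    · have hxb : b < x := not_le.1 fun h => hxab ⟨hxa, h⟩
      change ∫ t in (0 : ℝ)..x, g t = 0
      rw [intervalIntegral.integral_of_le (ha0.le.trans hxa)]
      refine Eq.trans ?_ h0
      refine setIntegral_eq_integral_of_forall_compl_eq_zero fun t ht => ?_
      refine image_eq_zero_of_notMem_tsupport fun h' => ht ⟨hs h', (hb h').trans hxb.le⟩
  refine ⟨fun x => ∫ t in (0 : ℝ)..x, g t, ?_, ?_, ?_, hderiv⟩
  · exact contDiff_infty_iff_deriv.2 ⟨fun x => (hd x).differentiableAt, by rwa [hderiv]⟩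
  · exact isCompact_Icc.of_isClosed_subset (isClosed_tsupport _) hsub
  · exact hsub.trans fun x hx => ha0.trans_le hx.1

/-- There is a test function on `(0, ∞)` with integral `1`. -/
theorem exists_test_integral_eq_one : ∃ φ : ℝ → ℝ, ContDiff ℝ (⊤ : ℕ∞) φ ∧ HasCompactSupport φ ∧
    tsupport φ ⊆ Ioi (0 : ℝ) ∧ ∫ x, φ x = 1 := by
  let B : ContDiffBump (2 : ℝ) := ⟨1 / 2, 1, by norm_num, by norm_num⟩
  refine ⟨B.normed volume, B.contDiff_normed, B.hasCompactSupport_normed, ?_, B.integral_normed⟩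
  rw [B.tsupport_normed_eq]
  intro x hx
  rw [Metric.mem_closedBall, Real.dist_eq] at hx
  have h1 : |x - 2| ≤ 1 := hx
  rw [mem_Ioi]
  linarith [(abs_le.1 h1).1]

theorem integrableOn_test_smul_of_continuousOn {φ : ℝ → ℝ} (hφ : Continuous φ)
    (hc : HasCompactSupport φ) {f : ℝ → 𝕜} (hf : ContinuousOn f (Ici 0)) :
    IntegrableOn (fun x => φ x • f x) (Ioi 0) := by
  obtain ⟨R, hR⟩ := hc.isCompact.bddAbove
  have h1 : IntegrableOn (fun x => φ x • f x) (Icc 0 R) :=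
    (hφ.continuousOn.smul (hf.mono Icc_subset_Ici_self)).integrableOn_Icc
  refine (h1.of_forall_sdiff_eq_zero measurableSet_Ioi fun x hx => ?_)
  rw [image_eq_zero_of_notMem_tsupport fun h' => hx.2 ⟨le_of_lt hx.1, hR h'⟩, zero_smul]

/-- The lemma of du Bois-Reymond: a Sobolev function is a primitive of its weak derivative. -/
theorem HasWeakDeriv.exists_isPrimitive {u w : L2Half 𝕜} (h : HasWeakDeriv u w) :
    ∃ f : ℝ → 𝕜, IsPrimitive f w ∧ u =ᵐ[halfLine] f := by
  have hW := isPrimitive_integral w 0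
  set W : ℝ → 𝕜 := fun x => 0 + ∫ t in (0 : ℝ)..x, w t with hWdef
  obtain ⟨θ, hθ, hθc, hθs, hθ1⟩ := exists_test_integral_eq_one
  have hi {φ : ℝ → ℝ} (hφ : Continuous φ) (hc : HasCompactSupport φ) :
      Integrable (fun x => φ x • (u x - W x)) halfLine := by
    simp only [smul_sub]
    exact (integrable_test_smul hφ hc u).sub
      (integrableOn_test_smul_of_continuousOn hφ hc hW.continuousOn)
  -- `u - W` has weak derivative zero; it remains to see that it is constant.
  have hψ (ψ : ℝ → ℝ) (hψ : ContDiff ℝ (⊤ : ℕ∞) ψ) (hc : HasCompactSupport ψ)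
      (hs : tsupport ψ ⊆ Ioi (0 : ℝ)) : ∫ x in Ioi (0 : ℝ), deriv ψ x • (u x - W x) = 0 := by
    have hd : Continuous (deriv ψ) := hψ.continuous_deriv (by simp)
    simp only [smul_sub]
    rw [integral_sub (integrable_test_smul hd hc.deriv u)
      (integrableOn_test_smul_of_continuousOn hd hc.deriv hW.continuousOn), h ψ hψ hc hs,
      (hW.integral_deriv_smul hψ hc hs).2.2, sub_self]
  -- If `u - W` is constant, this weighted mean is its value, since `θ` has integral `1`.
  set c : 𝕜 := ∫ x in Ioi (0 : ℝ), θ x • (u x - W x) with hcdef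
  refine ⟨fun x => c + ∫ t in (0 : ℝ)..x, w t, isPrimitive_integral w c, ?_⟩
  have hdiff : LocallyIntegrableOn (fun x => u x - W x - c) (Ioi 0) := by
    refine (locallyIntegrableOn_iff isOpen_Ioi.isLocallyClosed).2 fun K hK hKc => ?_
    refine (Integrable.sub ?_ ?_).sub (integrableOn_const hKc.measure_lt_top.ne)
    · have h1 : MemLp u 2 (volume.restrict K) :=
        (Lp.memLp u).mono_measure (Measure.restrict_mono_set _ hK)
      have : IsFiniteMeasure (volume.restrict K) := ⟨by simpa using hKc.measure_lt_top⟩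
      exact h1.integrable (by norm_num)
    · exact (hW.continuousOn.mono (hK.trans Ioi_subset_Ici_self)).integrableOn_compact hKc
  have key : ∀ᵐ x ∂(volume : Measure ℝ), x ∈ Ioi (0 : ℝ) → u x - W x - c = 0 := by
    refine isOpen_Ioi.ae_eq_zero_of_integral_contDiff_smul_eq_zero hdiff fun g hg hc hs => ?_
    have h0 {F : ℝ → 𝕜} : ∫ x, g x • F x = ∫ x in Ioi (0 : ℝ), g x • F x := by
      refine (setIntegral_eq_integral_of_forall_compl_eq_zero fun x hx => ?_).symm
      rw [image_eq_zero_of_notMem_tsupport fun h => hx (hs h), zero_smul]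
    -- Subtracting `(∫ g) θ` removes the mean of `g`, so the rest is the derivative of a test
    -- function and `∫ g (u - W) = (∫ g) c`.
    obtain ⟨ψ, hψ1, hψ2, hψ3, hψ4⟩ := exists_test_primitive
      (g := fun x => g x - (∫ y, g y) * θ x) (hg.sub (contDiff_const.mul hθ))
      (hc.sub (hθc.mul_left (f := fun _ => ∫ y, g y)))
      ((tsupport_sub _ _).trans (union_subset hs ((tsupport_mul_subset_right).trans hθs)))
      (by rw [integral_sub (hg.continuous.integrable_of_hasCompactSupport hc)
            ((hθ.continuous.integrable_of_hasCompactSupport hθc).const_mul _),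
            integral_const_mul, hθ1, mul_one, sub_self])
    have h1 := hψ ψ hψ1 hψ2 hψ3
    simp only [hψ4, sub_smul, mul_smul] at h1
    rw [integral_sub (hi hg.continuous hc) ((hi hθ.continuous hθc).fun_smul _), integral_smul,
      ← hcdef] at h1
    rw [h0]
    simp only [smul_sub (g _) (_ - _) c]
    have h2 : ∫ x in Ioi (0 : ℝ), g x • c = (∫ y, g y) • c := by
      rw [← h0, integral_smul_const]
    rw [integral_sub (hi hg.continuous hc), h2, h1]
    exact ((hg.continuous.integrable_of_hasCompactSupport hc).smul_const c).integrableOn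
  rw [EventuallyEq, ae_restrict_iff' measurableSet_Ioi]
  filter_upwards [key] with x hx hx0
  have h1 := hx hx0
  simp only [hWdef] at h1
  linear_combination h1

theorem MemH1.hasValueAtZero {u : L2Half 𝕜} (h : MemH1 u) : HasValueAtZero u (valueAtZero u) := by
  obtain ⟨f, hf, hu⟩ := h.hasWeakDeriv.exists_isPrimitive
  have h1 : HasValueAtZero u (f 0) := ⟨f, hf.continuousOn, hu, rfl⟩
  rwa [h1.valueAtZero_eq]

theorem MemH1.exists_isPrimitive {u : L2Half 𝕜} (h : MemH1 u) :
    ∃ f : ℝ → 𝕜, IsPrimitive f (weakDeriv u) ∧ u =ᵐ[halfLine] f ∧ f 0 = valueAtZero u := by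
  obtain ⟨f, hf, hu⟩ := h.hasWeakDeriv.exists_isPrimitive
  exact ⟨f, hf, hu, (HasValueAtZero.valueAtZero_eq ⟨f, hf.continuousOn, hu, rfl⟩).symm⟩

/-- Integration by parts on the half-line. -/
theorem MemH1.inner_weakDeriv_add {u v : L2Half 𝕜} (hu : MemH1 u) (hv : MemH1 v) :
    inner 𝕜 v (weakDeriv u) + inner 𝕜 (weakDeriv v) u
      = - (valueAtZero u * conj (valueAtZero v)) := by
  obtain ⟨f, hf, huf, hf0⟩ := hu.exists_isPrimitive
  obtain ⟨g, hg, hvg, hg0⟩ := hv.exists_isPrimitive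
  have i1 := L2.integrable_inner (𝕜 := 𝕜) v (weakDeriv u)
  have i2 := L2.integrable_inner (𝕜 := 𝕜) (weakDeriv v) u
  have i3 := L2.integrable_inner (𝕜 := 𝕜) v u
  rw [L2.inner_def, L2.inner_def, ← integral_add i1 i2, ← hf0, ← hg0]
  have hae : (fun x => inner 𝕜 (v x) (weakDeriv u x) + inner 𝕜 (weakDeriv v x) (u x))
      =ᵐ[halfLine] fun x => weakDeriv u x * conj (g x) + f x * conj (weakDeriv v x) := by
    filter_upwards [huf, hvg] with x h1 h2
    rw [RCLike.inner_apply, RCLike.inner_apply, h1, h2]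
  rw [integral_congr_ae hae]
  -- `f · conj g` and its derivative are built from products of `L²` functions, hence integrable; no
  -- decay at infinity has to be shown separately.
  refine (hf.mul hg.conj).integral_eq (i3.congr ?_) ((i1.add i2).congr hae)
  filter_upwards [huf, hvg] with x h1 h2
  rw [RCLike.inner_apply, h1, h2]

/-- The trace inequality. -/
theorem MemH1.norm_valueAtZero_sq_le {u : L2Half 𝕜} (hu : MemH1 u) :
    ‖valueAtZero u‖ ^ 2 ≤ 2 * (‖u‖ * ‖weakDeriv u‖) := by
  -- Integration by parts with `v = u`.
  have h := congrArg norm (hu.inner_weakDeriv_add hu)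
  rw [norm_neg, norm_mul, RCLike.norm_conj, ← sq] at h
  rw [← h]
  refine (norm_add_le _ _).trans ?_
  have h1 := norm_inner_le_norm (𝕜 := 𝕜) u (weakDeriv u)
  have h2 := norm_inner_le_norm (𝕜 := 𝕜) (weakDeriv u) u
  linarith

theorem valueAtZero_add {u v : L2Half 𝕜} (hu : MemH1 u) (hv : MemH1 v) :
    valueAtZero (u + v) = valueAtZero u + valueAtZero v :=
  (hu.hasValueAtZero.add hv.hasValueAtZero).valueAtZero_eq

theorem valueAtZero_smul {u : L2Half 𝕜} (c : 𝕜) (hu : MemH1 u) :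
    valueAtZero (c • u) = c * valueAtZero u :=
  (hu.hasValueAtZero.smul c).valueAtZero_eq

/-- Rewrites the defining identity of weak derivatives in terms of inner products, so that limits
and orthogonality apply to it. -/
theorem integral_test_smul_eq_inner {φ : ℝ → ℝ} (hφ : MemLp (fun x => (φ x : 𝕜)) 2 halfLine)
    (u : L2Half 𝕜) : ∫ x in Ioi (0 : ℝ), φ x • u x = inner 𝕜 (hφ.toLp _) u := by
  rw [L2.inner_def]
  refine integral_congr_ae ?_
  filter_upwards [hφ.coeFn_toLp] with x hx
  rw [hx, RCLike.inner_apply, RCLike.conj_ofReal, RCLike.real_smul_eq_coe_mul, mul_comm]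

theorem memLp_test {φ : ℝ → ℝ} (hφ : Continuous φ) (hc : HasCompactSupport φ) :
    MemLp (fun x => (φ x : 𝕜)) 2 halfLine :=
  ((hφ.memLp_of_hasCompactSupport (μ := volume) hc).restrict _).ofReal

/-- The weak derivative is a closed operator. -/
theorem HasWeakDeriv.of_tendsto {u w : ℕ → L2Half 𝕜} {u₀ w₀ : L2Half 𝕜}
    (h : ∀ n, HasWeakDeriv (u n) (w n)) (hu : Tendsto u atTop (𝓝 u₀))
    (hw : Tendsto w atTop (𝓝 w₀)) : HasWeakDeriv u₀ w₀ := by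
  intro φ hφ hc hs
  have hd := memLp_test (𝕜 := 𝕜) (hφ.continuous_deriv (by simp)) hc.deriv
  have h0 := memLp_test (𝕜 := 𝕜) hφ.continuous hc
  rw [integral_test_smul_eq_inner hd, integral_test_smul_eq_inner h0]
  refine tendsto_nhds_unique (tendsto_const_nhds.inner hu) ?_
  refine (tendsto_const_nhds.inner hw).neg.congr fun n => ?_
  rw [← integral_test_smul_eq_inner hd, ← integral_test_smul_eq_inner h0, h n φ hφ hc hs]

/-- Test functions, as Sobolev functions with zero boundary value. -/
theorem hasWeakDeriv_test {φ : ℝ → ℝ} (hφ : ContDiff ℝ (⊤ : ℕ∞) φ) (hc : HasCompactSupport φ)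
    (hs : tsupport φ ⊆ Ioi (0 : ℝ)) :
    HasWeakDeriv ((memLp_test (𝕜 := 𝕜) hφ.continuous hc).toLp _)
      ((memLp_test (𝕜 := 𝕜) (hφ.continuous_deriv (by simp)) hc.deriv).toLp _) ∧
    HasValueAtZero ((memLp_test (𝕜 := 𝕜) hφ.continuous hc).toLp _) 0 := by
  refine ⟨(isPrimitive_test hφ).hasWeakDeriv (MemLp.coeFn_toLp _) (MemLp.coeFn_toLp _),
    _, (RCLike.continuous_ofReal.comp hφ.continuous).continuousOn, MemLp.coeFn_toLp _, ?_⟩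
  rw [Function.comp_apply,
    image_eq_zero_of_notMem_tsupport fun h' => lt_irrefl (0 : ℝ) (hs h'), RCLike.ofReal_zero]

theorem memLp_exp_neg : MemLp (fun x => (Real.exp (-x) : 𝕜)) 2 halfLine := by
  refine MemLp.ofReal ((memLp_two_iff_integrable_sq ?_).2 ?_)
  · exact (Real.continuous_exp.comp continuous_neg).aestronglyMeasurable
  · have h := integrableOn_exp_mul_Ioi (a := -2) (by norm_num) 0
    refine h.congr_fun (fun x _ => ?_) measurableSet_Ioi
    rw [← Real.exp_nat_mul]
    push_cast
    ring_nf

-- The function `e^{-x}`, placed on every edge, detects the vertex condition.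
variable (𝕜) in
theorem exists_memH1_valueAtZero_eq_one : ∃ u : L2Half 𝕜, MemH1 u ∧ HasValueAtZero u 1 := by
  have hc : Continuous fun x : ℝ => (Real.exp (-x) : 𝕜) :=
    RCLike.continuous_ofReal.comp (Real.continuous_exp.comp continuous_neg)
  have hp : IsPrimitive (fun x : ℝ => (Real.exp (-x) : 𝕜)) (fun x => -(Real.exp (-x) : 𝕜)) :=
    isPrimitive_of_hasDerivAt hc.neg fun x => by
      have h1 := ((Real.hasDerivAt_exp (-x)).comp x (hasDerivAt_neg x)).rclike_ofReal (𝕜 := 𝕜)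
      simpa using! h1
  refine ⟨memLp_exp_neg.toLp _, ⟨memLp_exp_neg.neg.toLp _, hp.hasWeakDeriv
    (MemLp.coeFn_toLp _) (MemLp.coeFn_toLp _)⟩, _, hc.continuousOn, MemLp.coeFn_toLp _, by simp⟩

end StarGraph

end

noncomputable section

namespace StarGraph

/-! ## Schrödinger operators with a delta vertex condition -/

section Multiplication

variable {𝕜 : Type*} [RCLike 𝕜]

theorem mulBounded_coe {q : ℝ → ℝ} (hq : MemLp q ∞ halfLine) (u : L2Half 𝕜) :
    mulBounded q hq u =ᵐ[halfLine] fun x => (q x : 𝕜) * u x :=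
  MemLp.coeFn_toLp (MemLp.mul' (r := 2) (Lp.memLp u) hq.ofReal)

theorem inner_mulBounded {q : ℝ → ℝ} (hq : MemLp q ∞ halfLine) (u v : L2Half 𝕜) :
    inner 𝕜 v (mulBounded q hq u) = inner 𝕜 (mulBounded q hq v) u := by
  rw [L2.inner_def, L2.inner_def]
  refine integral_congr_ae ?_
  filter_upwards [mulBounded_coe hq u, mulBounded_coe hq v] with x h1 h2
  rw [h1, h2, RCLike.inner_apply, RCLike.inner_apply, map_mul, RCLike.conj_ofReal]
  ring

theorem exists_norm_mulBounded_le {q : ℝ → ℝ} (hq : MemLp q ∞ halfLine) :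
    ∃ C : ℝ, 0 ≤ C ∧ ∀ u : L2Half 𝕜, ‖mulBounded q hq u‖ ≤ C * ‖u‖ := by
  refine ⟨(eLpNorm q ∞ halfLine).toReal, ENNReal.toReal_nonneg, fun u => ?_⟩
  refine Lp.norm_le_mul_norm_of_ae_le_mul ?_
  filter_upwards [mulBounded_coe hq u, ae_le_eLpNormEssSup (f := q) (μ := halfLine)] with x h1 h2
  rw [h1, norm_mul, RCLike.norm_ofReal, ← Real.norm_eq_abs]
  gcongr
  rw [← eLpNorm_exponent_top] at h2
  simpa using ENNReal.toReal_mono hq.eLpNorm_ne_top h2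

end Multiplication

section Robin

variable {𝕜 : Type*} [RCLike 𝕜] {N : ℕ}

/-- The edgewise weak derivative. -/
def derivStar (V : L2Star 𝕜 N) : L2Star 𝕜 N := WithLp.toLp 2 fun j => weakDeriv (V j)

/-- The edgewise multiplication by bounded potentials. -/
def mulStar (q : Fin N → ℝ → ℝ) (hq : ∀ j, MemLp (q j) ∞ halfLine) :
    L2Star 𝕜 N →ₗ[𝕜] L2Star 𝕜 N where
  toFun V := WithLp.toLp 2 fun j => mulBounded (q j) (hq j) (V j)
  map_add' U V := by ext1 j; simp
  map_smul' c V := by ext1 j; simp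

theorem derivStar_apply (V : L2Star 𝕜 N) (j : Fin N) : derivStar V j = weakDeriv (V j) := rfl

theorem mulStar_apply (q : Fin N → ℝ → ℝ) (hq : ∀ j, MemLp (q j) ∞ halfLine) (V : L2Star 𝕜 N)
    (j : Fin N) : mulStar q hq V j = mulBounded (q j) (hq j) (V j) := rfl

theorem derivStar_add {U V : L2Star 𝕜 N} (hU : U ∈ energySpace 𝕜 N) (hV : V ∈ energySpace 𝕜 N) :
    derivStar (U + V) = derivStar U + derivStar V := by
  ext1 j
  exact weakDeriv_add (hU.1 j) (hV.1 j)

theorem derivStar_smul (c : 𝕜) {U : L2Star 𝕜 N} (hU : U ∈ energySpace 𝕜 N) :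
    derivStar (c • U) = c • derivStar U := by
  ext1 j
  exact weakDeriv_smul c (hU.1 j)

theorem derivStar_sub {U V : L2Star 𝕜 N} (hU : U ∈ energySpace 𝕜 N) (hV : V ∈ energySpace 𝕜 N) :
    derivStar (U - V) = derivStar U - derivStar V := by
  rw [sub_eq_add_neg, ← neg_one_smul 𝕜 V, derivStar_add hU (Submodule.smul_mem _ _ hV),
    derivStar_smul _ hV, neg_one_smul, ← sub_eq_add_neg]

theorem inner_mulStar (q : Fin N → ℝ → ℝ) (hq : ∀ j, MemLp (q j) ∞ halfLine) (U V : L2Star 𝕜 N) :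
    inner 𝕜 V (mulStar q hq U) = inner 𝕜 (mulStar q hq V) U := by
  simp only [PiLp.inner_apply, mulStar_apply, inner_mulBounded]

theorem exists_norm_mulStar_le (q : Fin N → ℝ → ℝ) (hq : ∀ j, MemLp (q j) ∞ halfLine) :
    ∃ C : ℝ, 0 ≤ C ∧ ∀ V : L2Star 𝕜 N, ‖mulStar q hq V‖ ≤ C * ‖V‖ := by
  choose C hC0 hC using fun j => exists_norm_mulBounded_le (𝕜 := 𝕜) (hq j)
  -- The sum of the edge bounds serves as a common bound.
  have h0 : 0 ≤ ∑ j, C j := Finset.sum_nonneg fun j _ => hC0 j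
  refine ⟨∑ j, C j, h0, fun V => ?_⟩
  refine le_of_sq_le_sq ?_ (by positivity)
  rw [mul_pow, PiLp.norm_sq_eq_of_L2, PiLp.norm_sq_eq_of_L2, Finset.mul_sum]
  refine Finset.sum_le_sum fun j _ => ?_
  rw [← mul_pow, mulStar_apply]
  have h1 : C j ≤ ∑ i, C i := Finset.single_le_sum (fun i _ => hC0 i) (Finset.mem_univ j)
  exact pow_le_pow_left₀ (norm_nonneg _) ((hC j _).trans (by gcongr)) 2

theorem norm_valueAtZero_sq_le {V : L2Star 𝕜 N} (hV : ∀ j, MemH1 (V j)) (j : Fin N) :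
    ‖valueAtZero (V j)‖ ^ 2 ≤ 2 * (‖V‖ * ‖derivStar V‖) := by
  refine (hV j).norm_valueAtZero_sq_le.trans ?_
  have h1 := PiLp.norm_apply_le V j
  have h2 := PiLp.norm_apply_le (derivStar V) j
  rw [derivStar_apply] at h2
  gcongr

/-- Extension by zero to the other edges respects continuity at the vertex when the boundary value
is zero. This allows testing one edge at a time. -/
theorem single_mem_energySpace {φ : L2Half 𝕜} (h1 : MemH1 φ) (h0 : HasValueAtZero φ 0)
    (j : Fin N) : (WithLp.toLp 2 (Pi.single j φ) : L2Star 𝕜 N) ∈ energySpace 𝕜 N := by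
  refine ⟨fun i => ?_, 0, fun i => ?_⟩
  all_goals
    rcases eq_or_ne i j with rfl | hij
    · simpa using by assumption
    · simp only [Pi.single_eq_of_ne hij]
      first | exact ⟨0, HasWeakDeriv.zero⟩ | exact HasValueAtZero.zero

theorem inner_single {φ : L2Half 𝕜} (j : Fin N) (V : L2Star 𝕜 N) :
    inner 𝕜 (WithLp.toLp 2 (Pi.single j φ) : L2Star 𝕜 N) V = inner 𝕜 φ (V j) := by
  rw [PiLp.inner_apply, Finset.sum_eq_single j]
  · simp
  · intro i _ hij
    simp [Pi.single_eq_of_ne hij]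
  · simp

theorem derivStar_single (φ : L2Half 𝕜) (j : Fin N) :
    derivStar (WithLp.toLp 2 (Pi.single j φ) : L2Star 𝕜 N)
      = WithLp.toLp 2 (Pi.single j (weakDeriv φ)) := by
  ext1 i
  rcases eq_or_ne i j with rfl | hij
  · simp [derivStar_apply]
  · simp only [derivStar_apply, Pi.single_eq_of_ne hij, weakDeriv_zero]

/-- If `W` is orthogonal to the energy space, each `W_j` annihilates all test functions. Thus `W_j`
is a weak derivative of `0`, and uniqueness gives `W_j = 0`. -/
theorem dense_energySpace : Dense (energySpace 𝕜 N : Set (L2Star 𝕜 N)) := by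
  rw [Submodule.dense_iff_topologicalClosure_eq_top, Submodule.topologicalClosure_eq_top_iff,
    Submodule.eq_bot_iff]
  intro W hW
  ext1 j
  refine HasWeakDeriv.unique (u := 0) (fun φ hφ hc hs => ?_) HasWeakDeriv.zero
  obtain ⟨hd, h0⟩ := hasWeakDeriv_test (𝕜 := 𝕜) hφ hc hs
  have h1 := (Submodule.mem_orthogonal _ _).1 hW _ (single_mem_energySpace ⟨_, hd⟩ h0 j)
  rw [inner_single] at h1
  rw [integral_test_smul_eq_inner (memLp_test (hφ.continuous_deriv (by simp)) hc.deriv),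
    integral_test_smul_eq_inner (memLp_test hφ.continuous hc), h1, inner_zero_right, neg_zero]

variable [NeZero N]

/-- The boundary value at the vertex. -/
theorem hasValueAtZero_of_mem_energySpace {V : L2Star 𝕜 N} (hV : V ∈ energySpace 𝕜 N)
    (j : Fin N) : HasValueAtZero (V j) (valueAtZero (V 0)) := by
  obtain ⟨_, a, ha⟩ := hV
  rw [(ha 0).valueAtZero_eq]
  exact ha j

/-- The form `(F', G')₂ + (q F, G)₂ + α F(0) G(0)`, with complex conjugation on `G`. -/
def robinForm (α : ℝ) (q : Fin N → ℝ → ℝ) (hq : ∀ j, MemLp (q j) ∞ halfLine)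
    (F G : L2Star 𝕜 N) : 𝕜 :=
  inner 𝕜 (derivStar G) (derivStar F) + inner 𝕜 G (mulStar q hq F)
    + (α : 𝕜) * (valueAtZero (F 0) * conj (valueAtZero (G 0)))

variable (α : ℝ) (q : Fin N → ℝ → ℝ) (hq : ∀ j, MemLp (q j) ∞ halfLine)

/-- The form controls the norm of the derivative, and conversely. -/
theorem exists_robinForm_bounds : ∃ K : ℝ, 0 ≤ K ∧ ∀ F ∈ energySpace 𝕜 N,
    ‖derivStar F‖ ^ 2 / 2 - K * ‖F‖ ^ 2 ≤ RCLike.re (robinForm α q hq F F) ∧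
    ‖robinForm α q hq F F‖ ≤ 2 * ‖derivStar F‖ ^ 2 + K * ‖F‖ ^ 2 := by
  obtain ⟨C, hC0, hC⟩ := exists_norm_mulStar_le (𝕜 := 𝕜) q hq
  -- The part `C` bounds the potential. The part `2 α²` comes from the trace inequality and Young:
  -- `2 |α| ‖F‖ ‖F'‖ ≤ ‖F'‖² / 2 + 2 α² ‖F‖²`.
  refine ⟨C + 2 * α ^ 2, by positivity, fun F hF => ?_⟩
  have h1 : ‖inner 𝕜 F (mulStar q hq F)‖ ≤ C * ‖F‖ ^ 2 := by
    refine (norm_inner_le_norm _ _).trans ?_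
    have := mul_le_mul_of_nonneg_left (hC F) (norm_nonneg F)
    linarith
  have h2 : ‖(α : 𝕜) * (valueAtZero (F 0) * conj (valueAtZero (F 0)))‖
      ≤ ‖derivStar F‖ ^ 2 / 2 + 2 * α ^ 2 * ‖F‖ ^ 2 := by
    rw [norm_mul, norm_mul, RCLike.norm_conj, RCLike.norm_ofReal, ← sq]
    have h3 := mul_le_mul_of_nonneg_left (norm_valueAtZero_sq_le hF.1 0) (abs_nonneg α)
    have h4 := sq_nonneg (‖derivStar F‖ - 2 * (|α| * ‖F‖))
    have h5 : (|α| * ‖F‖) ^ 2 = α ^ 2 * ‖F‖ ^ 2 := by rw [mul_pow, sq_abs]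
    linarith
  have h3 : ‖inner 𝕜 (derivStar F) (derivStar F)‖ = ‖derivStar F‖ ^ 2 := by
    rw [inner_self_eq_norm_sq_to_K, norm_pow, RCLike.norm_ofReal, abs_of_nonneg (norm_nonneg _)]
  constructor
  · rw [robinForm, map_add, map_add, inner_self_eq_norm_sq]
    have h4 := (abs_le.1 ((RCLike.abs_re_le_norm _).trans h1)).1
    have h5 := (abs_le.1 ((RCLike.abs_re_le_norm _).trans h2)).1
    linarith
  · refine (norm_add_le _ _).trans ?_
    have h4 := norm_add_le (inner 𝕜 (derivStar F) (derivStar F)) (inner 𝕜 F (mulStar q hq F))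
    nlinarith [sq_nonneg ‖derivStar F‖]

/-- By the two-sided bounds, a form-Cauchy sequence that converges in `L²` is Cauchy in `H¹`.
Closedness of the weak derivative identifies the limit, and the trace inequality carries the common
vertex value over to it. -/
theorem robinForm_closed (u : ℕ → L2Star 𝕜 N) (v : L2Star 𝕜 N) (hu : ∀ n, u n ∈ energySpace 𝕜 N)
    (hv : Tendsto u atTop (𝓝 v))
    (hcau : ∀ ε : ℝ, 0 < ε → ∃ n₀ : ℕ, ∀ m n : ℕ, n₀ ≤ m → n₀ ≤ n →
      ‖robinForm α q hq (u n - u m) (u n - u m)‖ < ε) :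
    v ∈ energySpace 𝕜 N ∧
      Tendsto (fun n => robinForm α q hq (u n - v) (u n - v)) atTop (𝓝 0) := by
  obtain ⟨K, hK0, hK⟩ := exists_robinForm_bounds (𝕜 := 𝕜) α q hq
  have hder : CauchySeq fun n => derivStar (u n) := by
    refine Metric.cauchySeq_iff.2 fun ε hε => ?_
    -- The thresholds give `‖u_m' - u_n'‖² / 2 < ε² / 4 + K ε² / (4 (K + 1)) ≤ ε² / 2`; the `K + 1`
    -- covers `K = 0`.
    obtain ⟨n₁, h₁⟩ := hcau (ε ^ 2 / 4) (by positivity)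
    obtain ⟨n₂, h₂⟩ := Metric.cauchySeq_iff.1 hv.cauchySeq (√(ε ^ 2 / (4 * (K + 1))))
      (by positivity)
    refine ⟨max n₁ n₂, fun m hm n hn => ?_⟩
    have h3 := h₁ n m ((le_max_left _ _).trans hn) ((le_max_left _ _).trans hm)
    have h4 := h₂ m ((le_max_right _ _).trans hm) n ((le_max_right _ _).trans hn)
    rw [dist_eq_norm, Real.lt_sqrt (norm_nonneg _), lt_div_iff₀ (by positivity)] at h4
    have h5 := (hK _ (Submodule.sub_mem _ (hu m) (hu n))).1
    rw [derivStar_sub (hu m) (hu n)] at h5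
    have h6 := (RCLike.re_le_norm _).trans_lt h3
    rw [dist_eq_norm]
    refine lt_of_pow_lt_pow_left₀ 2 hε.le ?_
    nlinarith [sq_nonneg ‖u m - u n‖]
  obtain ⟨w, hw⟩ := cauchySeq_tendsto_of_complete hder
  have happ {a : ℕ → L2Star 𝕜 N} {b : L2Star 𝕜 N} (h : Tendsto a atTop (𝓝 b)) (j : Fin N) :
      Tendsto (fun n => a n j) atTop (𝓝 (b j)) :=
    ((PiLp.continuous_apply 2 _ j).tendsto b).comp h
  have hweak (j : Fin N) : HasWeakDeriv (v j) (w j) :=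
    HasWeakDeriv.of_tendsto (fun n => ((hu n).1 j).hasWeakDeriv) (happ hv j) (happ hw j)
  have hvw : derivStar v = w := by
    ext1 j
    exact (hweak j).weakDeriv_eq
  have hv1 (j : Fin N) : MemH1 (v j) := ⟨_, hweak j⟩
  -- It is not yet known that `v` lies in the energy space, so differences with `v` are handled edge
  -- by edge.
  have hsub1 (n : ℕ) (j : Fin N) : MemH1 ((u n - v) j) := by
    rw [PiLp.sub_apply, sub_eq_add_neg, ← neg_one_smul 𝕜]
    exact ((hu n).1 j).add ((hv1 j).smul _)
  have hsubd (n : ℕ) : derivStar (u n - v) = derivStar (u n) - w := by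
    ext1 j
    rw [derivStar_apply, PiLp.sub_apply, PiLp.sub_apply, sub_eq_add_neg, ← neg_one_smul 𝕜 (v j),
      weakDeriv_add ((hu n).1 j) ((hv1 j).smul _), weakDeriv_smul _ (hv1 j), neg_one_smul,
      ← sub_eq_add_neg, (hweak j).weakDeriv_eq, derivStar_apply]
  have hn1 := tendsto_iff_norm_sub_tendsto_zero.1 hv
  have hn2 := tendsto_iff_norm_sub_tendsto_zero.1 hw
  have hval (j : Fin N) : Tendsto (fun n => valueAtZero (u n j)) atTop (𝓝 (valueAtZero (v j))) := by
    rw [tendsto_iff_norm_sub_tendsto_zero]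
    have h1 : Tendsto (fun n => ‖valueAtZero (u n j) - valueAtZero (v j)‖ ^ 2) atTop (𝓝 0) := by
      refine squeeze_zero (fun n => sq_nonneg _) (fun n => ?_)
        (by simpa using (hn1.mul hn2).const_mul 2)
      have h2 := norm_valueAtZero_sq_le (hsub1 n) j
      rw [hsubd, PiLp.sub_apply, sub_eq_add_neg, ← neg_one_smul 𝕜 (v j),
        valueAtZero_add ((hu n).1 j) ((hv1 j).smul _), valueAtZero_smul _ (hv1 j), neg_one_mul,
        ← sub_eq_add_neg] at h2
      exact h2
    simpa using h1.sqrt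
  have hvE : v ∈ energySpace 𝕜 N := by
    refine ⟨hv1, valueAtZero (v 0), fun j => ?_⟩
    have h1 : valueAtZero (v j) = valueAtZero (v 0) :=
      tendsto_nhds_unique (hval j) ((hval 0).congr fun n =>
        (hasValueAtZero_of_mem_energySpace (hu n) j).valueAtZero_eq.symm)
    exact h1 ▸ (hv1 j).hasValueAtZero
  refine ⟨hvE, tendsto_zero_iff_norm_tendsto_zero.2 ?_⟩
  refine squeeze_zero (fun n => norm_nonneg _)
    (fun n => (hK _ (Submodule.sub_mem _ (hu n) hvE)).2) ?_
  simp only [hsubd]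
  simpa using ((hn2.pow 2).const_mul 2).add ((hn1.pow 2).const_mul K)

theorem isClosedSemiboundedForm_robinForm :
    IsClosedSemiboundedForm (energySpace 𝕜 N) (robinForm α q hq) where
  dense := dense_energySpace
  add_left u hu v hv z hz := by
    rw [robinForm, robinForm, robinForm, derivStar_add hu hv, inner_add_right, map_add,
      inner_add_right, PiLp.add_apply, valueAtZero_add (hu.1 0) (hv.1 0)]
    ring
  smul_left c u hu z hz := by
    rw [robinForm, robinForm, derivStar_smul c hu, inner_smul_right, map_smul,
      inner_smul_right, PiLp.smul_apply, valueAtZero_smul c (hu.1 0)]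
    ring
  symm u hu v hv := by
    rw [robinForm, robinForm, map_add, map_add, map_mul, map_mul, inner_conj_symm,
      RCLike.conj_ofReal, RCLike.conj_conj, inner_mulStar q hq u v, inner_conj_symm]
    ring
  bounded_below := by
    obtain ⟨K, hK0, hK⟩ := exists_robinForm_bounds (𝕜 := 𝕜) α q hq
    refine ⟨-K, fun u hu => ?_⟩
    have h1 := (hK u hu).1
    have h2 := sq_nonneg ‖derivStar u‖
    linarith
  closed := robinForm_closed α q hq

/-- Integration by parts in the form. -/
theorem robinForm_eq_of_memH2 {V Z : L2Star 𝕜 N} (hV : ∀ j, MemH2 (V j))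
    (hZ : Z ∈ energySpace 𝕜 N) :
    robinForm α q hq V Z = inner 𝕜 Z (mulStar q hq V - derivStar (derivStar V))
      + ((α : 𝕜) * valueAtZero (V 0) - ∑ j, valueAtZero (weakDeriv (V j)))
        * conj (valueAtZero (Z 0)) := by
  have h1 : inner 𝕜 (derivStar Z) (derivStar V) = - inner 𝕜 Z (derivStar (derivStar V))
      - (∑ j, valueAtZero (weakDeriv (V j))) * conj (valueAtZero (Z 0)) := by
    rw [PiLp.inner_apply, PiLp.inner_apply, Finset.sum_mul, ← Finset.sum_neg_distrib,
      ← Finset.sum_sub_distrib]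
    -- Each edge contributes `-V_j'(0) conj Z_j(0)`, and `Z_j(0)` is the same on all edges.
    refine Finset.sum_congr rfl fun j _ => ?_
    have h2 := (hV j).2.inner_weakDeriv_add (hZ.1 j)
    rw [(hasValueAtZero_of_mem_energySpace hZ j).valueAtZero_eq] at h2
    simp only [derivStar_apply]
    linear_combination h2
  rw [robinForm, h1, inner_sub_right]
  ring

/-- On `D_α` the boundary term of `robinForm_eq_of_memH2` vanishes. Conversely, a representing `W`
gives the equation on each edge first, and then the vertex condition from the boundary term that is
left. -/
theorem isAssociatedOperator_schrodinger :
    IsAssociatedOperator (energySpace 𝕜 N) (robinForm α q hq) (schrodinger 𝕜 α q hq) := by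
  have hval (V : L2Star 𝕜 N) (hV : V ∈ deltaDomain 𝕜 N α) : V ∈ energySpace 𝕜 N ∧
      (α : 𝕜) * valueAtZero (V 0) - ∑ j, valueAtZero (weakDeriv (V j)) = 0 := by
    obtain ⟨h2, a, b, ha, hb, hab⟩ := hV
    refine ⟨⟨fun j => (h2 j).1, a, ha⟩, ?_⟩
    simp only [(ha 0).valueAtZero_eq, fun j => (hb j).valueAtZero_eq, hab, sub_self]
  have hrep (V : (schrodinger 𝕜 α q hq).domain) (Z : L2Star 𝕜 N) (hZ : Z ∈ energySpace 𝕜 N) :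
      robinForm α q hq V Z = inner 𝕜 Z (schrodinger 𝕜 α q hq V) := by
    rw [robinForm_eq_of_memH2 α q hq V.2.1 hZ, (hval V V.2).2, zero_mul, add_zero]
    congr 1
    ext1 j
    exact sub_eq_neg_add _ _
  refine ⟨fun V => ⟨fun hV => ⟨(hval V hV).1, _, hrep ⟨V, hV⟩⟩, ?_⟩, hrep⟩
  rintro ⟨hVE, W, hW⟩
  -- Testing with `φ` on edge `j` alone kills the vertex term and leaves the weak equation `V_j'' =
  -- q_j V_j - W_j`.
  have hweak (j : Fin N) :
      HasWeakDeriv (weakDeriv (V j)) (mulStar q hq V j - W j) := by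
    intro φ hφ hc hs
    obtain ⟨hd, h0⟩ := hasWeakDeriv_test (𝕜 := 𝕜) hφ hc hs
    have h1 := hW _ (single_mem_energySpace ⟨_, hd⟩ h0 j)
    rw [robinForm, derivStar_single, inner_single, inner_single, inner_single, hd.weakDeriv_eq,
      derivStar_apply] at h1
    have h2 : valueAtZero ((WithLp.toLp 2 (Pi.single j ((memLp_test (𝕜 := 𝕜) hφ.continuous hc).toLp _))
        : L2Star 𝕜 N) 0) = 0 := by
      rcases eq_or_ne 0 j with rfl | hij
      · simpa using h0.valueAtZero_eq
      · simpa [Pi.single_eq_of_ne hij] using HasValueAtZero.zero.valueAtZero_eq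
    rw [h2, map_zero, mul_zero, mul_zero, add_zero] at h1
    rw [integral_test_smul_eq_inner (memLp_test (hφ.continuous_deriv (by simp)) hc.deriv),
      integral_test_smul_eq_inner (memLp_test hφ.continuous hc), inner_sub_right]
    linear_combination h1
  have hV2 (j : Fin N) : MemH2 (V j) := ⟨hVE.1 j, _, hweak j⟩
  have hWeq : mulStar q hq V - derivStar (derivStar V) = W := by
    ext1 j
    rw [PiLp.sub_apply, derivStar_apply, derivStar_apply, (hweak j).weakDeriv_eq, sub_sub_cancel]
  -- With `Z(0) = 1`, the surviving identity says that the coefficient `α V(0) - ∑ V_j'(0)` is zero.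
  obtain ⟨e, he, he1⟩ := exists_memH1_valueAtZero_eq_one 𝕜
  have hZ : (WithLp.toLp 2 (fun _ => e) : L2Star 𝕜 N) ∈ energySpace 𝕜 N :=
    ⟨fun _ => he, 1, fun _ => he1⟩
  have h1 := hW _ hZ
  rw [robinForm_eq_of_memH2 α q hq hV2 hZ, hWeq, PiLp.toLp_apply, he1.valueAtZero_eq, map_one,
    mul_one, add_eq_left, sub_eq_zero] at h1
  exact ⟨hV2, _, _, hasValueAtZero_of_mem_energySpace hVE, fun j => (hV2 j).2.hasValueAtZero,
    h1.symm⟩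

/-- The closed form and the self-adjoint operator associated with it. -/
theorem robinForm_representation :
    IsClosedSemiboundedForm (energySpace 𝕜 N) (robinForm α q hq) ∧
      IsSelfAdjoint (schrodinger 𝕜 α q hq) ∧
      ∀ L : L2Star 𝕜 N →ₗ.[𝕜] L2Star 𝕜 N,
        IsAssociatedOperator (energySpace 𝕜 N) (robinForm α q hq) L ↔ L = schrodinger 𝕜 α q hq := by
  have hform := isClosedSemiboundedForm_robinForm (𝕜 := 𝕜) α q hq
  have hass := isAssociatedOperator_schrodinger (𝕜 := 𝕜) α q hq
  exact ⟨hform, hform.isSelfAdjoint hass, fun L => ⟨fun hL => hL.unique hform.dense hass,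
    fun hL => hL ▸ hass⟩⟩

end Robin

/-! ### The forms of the theorem as instances of `robinForm` -/

theorem form_eq_robinForm {𝕜 : Type*} [RCLike 𝕜] {N : ℕ} [NeZero N] (k : ℕ) (α ω p c : ℝ)
    (hq : ∀ j, MemLp (potential N k α ω p c j) ∞ halfLine) :
    form 𝕜 N k α ω p c = robinForm α (potential N k α ω p c) hq := by
  funext F G
  rw [form, robinForm, PiLp.inner_apply, PiLp.inner_apply, ← Finset.sum_add_distrib]
  congr 1
  refine Finset.sum_congr rfl fun j _ => ?_
  rw [L2.inner_def, L2.inner_def, ← integral_add (L2.integrable_inner _ _) (L2.integrable_inner _ _)]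
  refine integral_congr_ae ?_
  filter_upwards [mulBounded_coe (hq j) (F j)] with x hx
  rw [mulStar_apply, hx, RCLike.inner_apply, RCLike.inner_apply, derivStar_apply, derivStar_apply,
    potential, RCLike.ofReal_sub]
  ring

end StarGraph

end
-- The equivalence with `L = schrodinger …` expresses at once that an associated operator exists, is
-- unique, has domain `D_α` and acts by the stated formula.
theorem theorem3p2 {𝕜 : Type*} [RCLike 𝕜] {N : ℕ} [NeZero N] (k : ℕ) (hk : k ≤ (N - 1) / 2)
    (α ω p : ℝ) (hα : α ≠ 0) (hp : 1 < p) (hω : α ^ 2 / ((N : ℝ) - 2 * k) ^ 2 < ω) :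
    (StarGraph.IsClosedSemiboundedForm (StarGraph.energySpace 𝕜 N) (StarGraph.formB1 𝕜 N k α ω p) ∧
      IsSelfAdjoint (StarGraph.schrodinger 𝕜 α (StarGraph.potential N k α ω p p)
          (StarGraph.memLp_potential p hp hω)) ∧
      ∀ L : StarGraph.L2Star 𝕜 N →ₗ.[𝕜] StarGraph.L2Star 𝕜 N,
        StarGraph.IsAssociatedOperator (StarGraph.energySpace 𝕜 N) (StarGraph.formB1 𝕜 N k α ω p) L ↔
          L = StarGraph.schrodinger 𝕜 α (StarGraph.potential N k α ω p p)
          (StarGraph.memLp_potential p hp hω)) ∧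
    (StarGraph.IsClosedSemiboundedForm (StarGraph.energySpace 𝕜 N) (StarGraph.formB2 𝕜 N k α ω p) ∧
      IsSelfAdjoint (StarGraph.schrodinger 𝕜 α (StarGraph.potential N k α ω p 1)
          (StarGraph.memLp_potential 1 hp hω)) ∧
      ∀ L : StarGraph.L2Star 𝕜 N →ₗ.[𝕜] StarGraph.L2Star 𝕜 N,
        StarGraph.IsAssociatedOperator (StarGraph.energySpace 𝕜 N) (StarGraph.formB2 𝕜 N k α ω p) L ↔
          L = StarGraph.schrodinger 𝕜 α (StarGraph.potential N k α ω p 1)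
          (StarGraph.memLp_potential 1 hp hω)) := by
  rw [StarGraph.formB1, StarGraph.formB2,
    StarGraph.form_eq_robinForm k α ω p p (StarGraph.memLp_potential p hp hω),
    StarGraph.form_eq_robinForm k α ω p 1 (StarGraph.memLp_potential 1 hp hω)]
  exact ⟨StarGraph.robinForm_representation _ _ _, StarGraph.robinForm_representation _ _ _⟩
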